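/- \textbf{Data (1)--(3).} (1) A hyperbolic lattice $S$: a free $\mathbb Z$-module of finite rank with a nondegenerate integral symmetric bilinear form $(\cdot,\cdot)$ of signature $(\operatorname{rk}S-1,1)$; write $x^2=(x,x)$. Fix a half $V^+$ of the cone $\{x\in S\otimes\mathbb R: x^2<0\}$ and let $O^+(S)$ be the subgroup of $O(S)$ preserving $V^+$. A root is an $\alpha\in S$ with $\alpha^2>0$ and $\alpha^2\mid 2(\alpha,S)$; its reflection is $s_\alpha(x)=x-\frac{2(x,\alpha)}{\alpha^2}\alpha$. (2) A non-trivial group $W\subset O(S)$ generated by reflections in some set of roots of $S$. (3) A fundamental chamber $\mathcal M\subset V^+/\mathbb R_{>0}$ of $W$, and a set $P=P_{\bar0}\sqcup P_{\bar1}$ of roots of $S$, minimal with the property $\mathcal M=\{\mathbb R_{>0}x : x\in V^+,\ (x,P)\le 0\}$, such that $2\alpha$ is a root for every $\alpha\in P_{\bar1}$, together with a Weyl vector $\rho\in S\otimes\mathbb Q$: $(\rho,\alpha)=-\alpha^2/2$ for all $\alpha\in P$. \textbf{Datum (4).} For some integer $m\ge1$ let $T=H(m)\oplus S$, where $H(m)=\mathbb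 Ze_1+\mathbb Ze_2$ with $e_1^2=e_2^2=0$, $(e_1,e_2)=-m$. Identify $\Omega=S\otimes\mathbb R+iV^+$ with a component of $\{\mathbb C\omega\subset T\otimes\mathbb C:(\omega,\omega)=0,\ (\omega,\bar\omega)<0\}$ by $z\mapsto\mathbb C\omega_z$, $\omega_z=\frac{(z,z)}2e_1+\frac1me_2+z$, and let $O^+(T)\subset O(T)$ be the subgroup preserving this component. Datum (4) is a holomorphic function $\Phi$ on $\Omega$ which is an automorphic form of some weight $k\in\frac12\mathbb Z$ for a subgroup $G\subset O^+(T)$ of finite index, with a character or multiplier system $\chi$ whose kernel has finite index in $G$ (that is, $\Phi(z')=\chi(g)c^k\Phi(z)$ whenever $g\in G$ and $g\omega_z=c\,\omega_{z'}$, with $c\in\mathbb C^*$), and which has a Fourier expansion $$\Phi(z)=\sum_{w\in W}\varepsilon(w)\Bigl(e^{-2\pi i(w(\rho),z)}-\sum_{a}m(a)\,e^{-2\pi i(w(\rho+a),z)}\Bigr),\qquad m(a)\in\mathbb Z,$$ where $a$ runs over the nonzero elements of $S\cap\overline{V^+}$ with $(a,P)\le0$, and $\varepsilon:W\to\{\pm1\}$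 is a homomorphism with $\varepsilon(s_\alpha)=-1$ for $\alpha\in P_{\bar0}$ and $\varepsilon(s_\alpha)=1$ for $\alpha\in P_{\bar1}$. \textbf{Symmetries.} Let $\mathrm{Sym}(\mathcal M)=\{g\in O^+(S): g(\mathcal M)=\mathcal M\}$ and $\mathrm{Sym}(P_{\bar1}\subset P)=\{g\in O^+(S): g(P)=P,\ g(P_{\bar1})=P_{\bar1}\}$. A non-trivial reflection group $W$ with fundamental chamber $\mathcal M$ has \emph{restricted arithmetic type} if the semidirect product $W\rtimes\mathrm{Sym}(\mathcal M)$ has finite index in $O(S)$. A nonzero $r\in S\otimes\mathbb Q$ is a \emph{generalized Weyl vector} for $W$ and $\mathcal M$ if the orbit $\mathrm{Sym}(\mathcal M)(r)$ is finite. A hyperbolic lattice $S$ is \emph{reflective} if it has a reflection group of restricted arithmetic type, with a fundamental chamber, that has a generalized Weyl vector $r\in S$. \textbf{Proposition.} Let $\operatorname{rk}S\ge3$ and let data (1)--(3) be given for which a datum (4) exists. Then (i) $\rho\ne0$ and $\rho^2\le0$; (ii) $W\rtimes\mathrm{Sym}(\mathcal M)$ has finite index in $O(S)$ and the orbit $\mathrm{Sym}(\mathcal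 M)(\rho)$ is finite; in particular, $S$ is reflective, $W$ has restricted arithmetic type, and $\rho$ is a generalized Weyl vector for $W$ and $\mathcal M$; (iii) $\mathrm{Sym}(P_{\bar1}\subset P)$ is a subgroup of finite index in $\mathrm{Sym}(\mathcal M)$; (iv) $g(\rho)=\rho$ for every $g\in\mathrm{Sym}(P_{\bar1}\subset P)$. -/

import Mathlib

open Matrix Set

noncomputable section

namespace LorentzianKM

/-! ### Lattices

A lattice of rank `n` is given by the Gram matrix `B` of a basis: the lattice is `ι → ℤ`, and
`ι → ℚ`, `ι → ℝ`, `ι → ℂ` are its extensions of scalars, all with the form `(x, y) = xᵀ B y`. -/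

section Lattice

variable {ι : Type*} [Fintype ι] [DecidableEq ι]

/-- The bilinear form with Gram matrix `B` on the lattice with scalars extended to `R`. -/
def form {R : Type*} [CommRing R] (B : Matrix ι ι ℤ) (x y : ι → R) : R :=
  x ⬝ᵥ (B.map (Int.cast : ℤ → R) *ᵥ y)

/-- A lattice vector, seen in the lattice with scalars extended to `R`. -/
def ofInt (R : Type*) [CommRing R] (a : ι → ℤ) : ι → R := fun i => (a i : R)

/-- The action of an automorphism of the `ℤ`-module, with scalars extended to `R`. -/
def act {R : Type*} [CommRing R] (g : GL ι ℤ) (x : ι → R) : ι → R :=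
  (g.val.map (Int.cast : ℤ → R)) *ᵥ x

theorem act_one {R : Type*} [CommRing R] : act (R := R) (1 : GL ι ℤ) = id := by
  funext x
  have h : ((1 : Matrix ι ι ℤ).map (Int.cast : ℤ → R)) = 1 :=
    Matrix.map_one _ Int.cast_zero Int.cast_one
  simp [act, h]

theorem act_mul {R : Type*} [CommRing R] (g h : GL ι ℤ) :
    act (R := R) (g * h) = act g ∘ act h := by
  funext x
  have e : ((g.val * h.val).map (Int.cast : ℤ → R))
      = g.val.map (Int.cast : ℤ → R) * h.val.map (Int.cast : ℤ → R) :=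
    Matrix.map_mul (f := Int.castRingHom R)
  simp [act, e, Matrix.mulVec_mulVec]

/-- The automorphisms of the `ℤ`-module that map the set `X` onto itself. -/
def setStab {R : Type*} [CommRing R] (X : Set (ι → R)) : Subgroup (GL ι ℤ) where
  carrier := {g | act g '' X = X}
  one_mem' := by simp [act_one]
  mul_mem' := by
    intro g h hg hh
    simp only [mem_ofPred_eq] at hg hh ⊢
    rw [act_mul, image_comp, hh, hg]
  inv_mem' := by
    intro g hg
    simp only [mem_ofPred_eq] at hg ⊢
    conv_lhs => rw [← hg]
    rw [← image_comp, ← act_mul, inv_mul_cancel, act_one, image_id]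

/-- The automorphism group `O(B)` of the lattice. -/
def orthGroup (B : Matrix ι ι ℤ) : Subgroup (GL ι ℤ) where
  carrier := {g | g.valᵀ * B * g.val = B}
  one_mem' := by simp
  mul_mem' := by
    intro g h hg hh
    simp only [mem_ofPred_eq] at hg hh ⊢
    calc (g * h).valᵀ * B * (g * h).val = h.valᵀ * (g.valᵀ * B * g.val) * h.val := by
          simp [Matrix.transpose_mul, Matrix.mul_assoc]
      _ = B := by rw [hg, hh]
  inv_mem' := by
    intro g hg
    simp only [mem_ofPred_eq] at hg ⊢
    have h1 : g.val * g⁻¹.val = 1 := g.mul_inv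
    have h2 : g⁻¹.valᵀ * g.valᵀ = 1 := by rw [← Matrix.transpose_mul, h1, Matrix.transpose_one]
    calc g⁻¹.valᵀ * B * g⁻¹.val = g⁻¹.valᵀ * (g.valᵀ * B * g.val) * g⁻¹.val := by rw [hg]
      _ = (g⁻¹.valᵀ * g.valᵀ) * B * (g.val * g⁻¹.val) := by simp only [Matrix.mul_assoc]
      _ = B := by rw [h1, h2, one_mul, mul_one]

/-- A hyperbolic lattice: an integral symmetric bilinear form which over `ℝ` has a vector of
negative square with positive definite orthogonal complement, that is, a nondegenerate form
with exactly one negative square. -/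
def IsHyperbolic (B : Matrix ι ι ℤ) : Prop :=
  B.IsSymm ∧ ∃ u : ι → ℝ, form B u u < 0 ∧ ∀ x : ι → ℝ, form B x u = 0 → x ≠ 0 → 0 < form B x x

/-- A root of the lattice: `α² > 0` and `α² ∣ 2 (α, x)` for all lattice vectors `x`. -/
def IsRoot (B : Matrix ι ι ℤ) (α : ι → ℤ) : Prop :=
  0 < form B α α ∧ ∀ x : ι → ℤ, form B α α ∣ 2 * form B α x

/-- `s` is the reflection `x ↦ x - (2 (x, α) / α²) α`. -/
def IsReflection (B : Matrix ι ι ℤ) (α : ι → ℤ) (s : GL ι ℤ) : Prop :=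
  ∀ x : ι → ℚ, act s x =
    x - (2 * form B x (ofInt ℚ α) / form B (ofInt ℚ α) (ofInt ℚ α)) • ofInt ℚ α

/-- A reflection group: a group generated by the reflections in some set of roots. -/
def IsReflectionGroup (B : Matrix ι ι ℤ) (W : Subgroup (GL ι ℤ)) : Prop :=
  ∃ R : Set (ι → ℤ), (∀ α ∈ R, IsRoot B α) ∧
    W = Subgroup.closure {s | ∃ α ∈ R, IsReflection B α s}

/-- The half `V⁺` of the cone `{x | x² < 0}` that contains `u`, where `u² < 0`. -/
def posCone (B : Matrix ι ι ℤ) (u : ι → ℝ) : Set (ι → ℝ) :=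
  {x | form B x x < 0 ∧ form B x u < 0}

/-- `O⁺(B)`: the automorphisms of the lattice that preserve the half cone `V⁺`. -/
def orthPlus (B : Matrix ι ι ℤ) (u : ι → ℝ) : Subgroup (GL ι ℤ) :=
  orthGroup B ⊓ setStab (posCone B u)

/-- The roots in whose mirrors `W` contains the reflection. -/
def rootsOf (B : Matrix ι ι ℤ) (W : Subgroup (GL ι ℤ)) : Set (ι → ℤ) :=
  {β | IsRoot B β ∧ ∃ s ∈ W, IsReflection B β s}

/-- `C` is (the cone in `V⁺` over) a fundamental chamber of `W`: all points of `V⁺` that lie, for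
every mirror of a reflection of `W`, weakly on the same side as a point `x₀` of `V⁺` which is on
none of the mirrors. -/
def IsChamber (B : Matrix ι ι ℤ) (u : ι → ℝ) (W : Subgroup (GL ι ℤ)) (C : Set (ι → ℝ)) : Prop :=
  ∃ x₀ ∈ posCone B u, (∀ β ∈ rootsOf B W, form B x₀ (ofInt ℝ β) ≠ 0) ∧
    C = {x ∈ posCone B u |
      ∀ β ∈ rootsOf B W, 0 ≤ form B x₀ (ofInt ℝ β) * form B x (ofInt ℝ β)}

/-- The symmetry group `Sym(𝓜) ⊆ O⁺(B)` of a chamber. -/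
def symChamber (B : Matrix ι ι ℤ) (u : ι → ℝ) (C : Set (ι → ℝ)) : Subgroup (GL ι ℤ) :=
  orthPlus B u ⊓ setStab C

/-- `W` and `Sym(𝓜)` form an (internal) semidirect product `W ⋊ Sym(𝓜) = W · Sym(𝓜)`, and this
subgroup has finite index in `O(B)`. -/
def SemidirectFiniteIndex (B : Matrix ι ι ℤ) (u : ι → ℝ) (W : Subgroup (GL ι ℤ))
    (C : Set (ι → ℝ)) : Prop :=
  W ⊔ symChamber B u C ≤ orthGroup B ∧
  symChamber B u C ≤ Subgroup.normalizer (W : Set (GL ι ℤ)) ∧ W ⊓ symChamber B u C = ⊥ ∧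
  (W ⊔ symChamber B u C).relIndex (orthGroup B) ≠ 0

/-- The reflection group `W` with fundamental chamber `C` has restricted arithmetic type. -/
def RestrictedArithmeticType (B : Matrix ι ι ℤ) (u : ι → ℝ) (W : Subgroup (GL ι ℤ))
    (C : Set (ι → ℝ)) : Prop :=
  IsReflectionGroup B W ∧ W ≠ ⊥ ∧ IsChamber B u W C ∧ SemidirectFiniteIndex B u W C

/-- A generalized Weyl vector for a chamber: a nonzero vector with finite orbit under the
symmetry group of the chamber. -/
def IsGeneralizedWeylVector (B : Matrix ι ι ℤ) (u : ι → ℝ) (C : Set (ι → ℝ)) (r : ι → ℚ) : Prop :=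
  r ≠ 0 ∧ {y | ∃ g ∈ symChamber B u C, y = act g r}.Finite

/-- A reflective hyperbolic lattice: some reflection group `W` of restricted arithmetic type has
a generalized Weyl vector in the lattice. -/
def IsReflective (B : Matrix ι ι ℤ) : Prop :=
  IsHyperbolic B ∧ ∃ (u : ι → ℝ) (W : Subgroup (GL ι ℤ)) (C : Set (ι → ℝ)) (r : ι → ℤ),
    form B u u < 0 ∧ RestrictedArithmeticType B u W C ∧
    IsGeneralizedWeylVector B u C (ofInt ℚ r)

end Lattice

/-! ### Data (1)-(3) -/

/-- Data (1)-(3): a hyperbolic lattice of rank `n` with a choice of the half cone `V⁺`, a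
non-trivial reflection group `W`, a fundamental chamber, the set `P = P₀ ∪ P₁` of roots
orthogonal to it, divided into even and odd ones, and a Weyl vector. -/
structure RootData (n : ℕ) where
  /-- the Gram matrix of the root lattice `S` -/
  B : Matrix (Fin n) (Fin n) ℤ
  hyperbolic : IsHyperbolic B
  /-- a vector in the chosen half cone `V⁺` -/
  u : Fin n → ℝ
  u_neg : form B u u < 0
  /-- the Weyl group -/
  W : Subgroup (GL (Fin n) ℤ)
  W_refl : IsReflectionGroup B W
  W_nontrivial : W ≠ ⊥
  /-- the cone over the fundamental chamber `𝓜` in `V⁺` -/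
  C : Set (Fin n → ℝ)
  C_chamber : IsChamber B u W C
  /-- the even simple real roots -/
  P₀ : Set (Fin n → ℤ)
  /-- the odd simple real roots -/
  P₁ : Set (Fin n → ℤ)
  disjoint : Disjoint P₀ P₁
  root : ∀ α ∈ P₀ ∪ P₁, IsRoot B α
  C_eq : C = {x ∈ posCone B u | ∀ α ∈ P₀ ∪ P₁, form B x (ofInt ℝ α) ≤ 0}
  minimal : ∀ Q ⊆ P₀ ∪ P₁,
    C = {x ∈ posCone B u | ∀ α ∈ Q, form B x (ofInt ℝ α) ≤ 0} → Q = P₀ ∪ P₁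
  odd : ∀ α ∈ P₁, IsRoot B (2 • α)
  /-- the Weyl vector -/
  ρ : Fin n → ℚ
  weyl : ∀ α ∈ P₀ ∪ P₁,
    form B ρ (ofInt ℚ α) = - form B (ofInt ℚ α) (ofInt ℚ α) / 2

/-- The set `P` of simple real roots. -/
def RootData.P {n : ℕ} (D : RootData n) : Set (Fin n → ℤ) := D.P₀ ∪ D.P₁

/-- The group `Sym(𝓜)`. -/
def RootData.symM {n : ℕ} (D : RootData n) : Subgroup (GL (Fin n) ℤ) := symChamber D.B D.u D.C

/-- The group `Sym(P₁ ⊆ P)`: the elements of `O⁺(S)` that preserve both `P` and `P₁`. -/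
def RootData.symP {n : ℕ} (D : RootData n) : Subgroup (GL (Fin n) ℤ) :=
  orthPlus D.B D.u ⊓ setStab D.P ⊓ setStab D.P₁

/-- The nonzero lattice vectors in the closed cone over the chamber: `a ∈ S`, `a ≠ 0`,
`a` in the closure of `V⁺`, `(a, P) ≤ 0`. -/
def RootData.chamberVectors {n : ℕ} (D : RootData n) : Set (Fin n → ℤ) :=
  {a | a ≠ 0 ∧ ofInt ℝ a ∈ closure (posCone D.B D.u) ∧ ∀ α ∈ D.P, form D.B a α ≤ 0}

/-! ### Automorphic forms and datum (4) -/

section Automorphic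

variable {n : ℕ}

/-- The complexified cone `Ω(V⁺) = S ⊗ ℝ + i V⁺`. -/
def tube (B : Matrix (Fin n) (Fin n) ℤ) (u : Fin n → ℝ) : Set (Fin n → ℂ) :=
  {z | (fun i => (z i).im) ∈ posCone B u}

/-- The Gram matrix of the extended lattice `T = H(m) ⊕ S`. -/
def extendedGram (B : Matrix (Fin n) (Fin n) ℤ) (m : ℕ) :
    Matrix (Fin 2 ⊕ Fin n) (Fin 2 ⊕ Fin n) ℤ :=
  Matrix.fromBlocks !![0, -(m : ℤ); -(m : ℤ), 0] 0 0 B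

/-- The isotropic vector `ω_z = ((z, z) / 2) e₁ + (1 / m) e₂ + z` of `T ⊗ ℂ`. -/
def omega (B : Matrix (Fin n) (Fin n) ℤ) (m : ℕ) (z : Fin n → ℂ) : Fin 2 ⊕ Fin n → ℂ :=
  Sum.elim ![form B z z / 2, 1 / (m : ℂ)] z

/-- The cone over the type IV domain `Ω(T)`: the component of
`{ω ∈ T ⊗ ℂ | (ω, ω) = 0, (ω, ω̄) < 0}` that consists of the multiples of the `ω_z`. -/
def omegaCone (B : Matrix (Fin n) (Fin n) ℤ) (u : Fin n → ℝ) (m : ℕ) :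
    Set (Fin 2 ⊕ Fin n → ℂ) :=
  {ω | ∃ c : ℂ, c ≠ 0 ∧ ∃ z ∈ tube B u, ω = c • omega B m z}

/-- `O⁺(T)`: the automorphisms of `T` that preserve the component `Ω(T)`. -/
def orthPlusT (B : Matrix (Fin n) (Fin n) ℤ) (u : Fin n → ℝ) (m : ℕ) :
    Subgroup (GL (Fin 2 ⊕ Fin n) ℤ) :=
  orthGroup (extendedGram B m) ⊓ setStab (omegaCone B u m)

/-- `Φ` is a holomorphic automorphic form on `Ω(T)`, `T = H(m) ⊕ S`, of weight `k = κ / 2` with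
respect to a subgroup `G` of `O⁺(T)` of finite index, with a character or multiplier system `χ`
whose kernel has finite index.

If `g ω_z = c ω_{z'}` then `Φ(z') = χ(g) c ^ k Φ(z)`. As `k` may be half-integral, `c ^ k` is a
continuous branch `J g z` on the tube of the square root of `c ^ κ`, and `χ J` has to be an
automorphy factor. For a multiplier system, to have a kernel of finite index means to take
finitely many values. -/
def IsAutomorphicForm (B : Matrix (Fin n) (Fin n) ℤ) (u : Fin n → ℝ) (m : ℕ) (κ : ℤ)
    (G : Subgroup (GL (Fin 2 ⊕ Fin n) ℤ)) (Φ : (Fin n → ℂ) → ℂ) : Prop :=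
  DifferentiableOn ℂ Φ (tube B u) ∧
  G ≤ orthPlusT B u m ∧ G.relIndex (orthPlusT B u m) ≠ 0 ∧
  ∃ (χ : GL (Fin 2 ⊕ Fin n) ℤ → ℂˣ) (J : GL (Fin 2 ⊕ Fin n) ℤ → (Fin n → ℂ) → ℂ),
    (χ '' (G : Set (GL (Fin 2 ⊕ Fin n) ℤ))).Finite ∧
    (∀ g ∈ G, ContinuousOn (J g) (tube B u)) ∧
    (∀ g ∈ G, ∀ z ∈ tube B u, ∀ z' ∈ tube B u, ∀ c : ℂ,
      act g (omega B m z) = c • omega B m z' →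
        J g z ^ 2 = c ^ κ ∧ Φ z' = χ g * J g z * Φ z ∧
        ∀ h ∈ G, χ (h * g) * J (h * g) z = (χ h * J h z') * (χ g * J g z))

/-- `exp(-2 π i (x, z))` for `x ∈ S ⊗ ℚ`, `z ∈ S ⊗ ℂ`. -/
def expo (B : Matrix (Fin n) (Fin n) ℤ) (x : Fin n → ℚ) (z : Fin n → ℂ) : ℂ :=
  Complex.exp (-2 * Real.pi * Complex.I * form B (fun i => (x i : ℂ)) z)

/-- Datum (4) for the data (1)-(3): a holomorphic automorphic form `Φ` with a Fourier expansion
`Φ(z) = ∑_{w ∈ W} ε(w) (exp(-2πi (w(ρ), z)) - ∑_a m(a) exp(-2πi (w(ρ + a), z)))` of the form of a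
denominator identity, with integers `m(a)` and a character `ε` of `W` with value `-1` at the
reflections in even and `1` at the reflections in odd simple roots. Fourier series of
holomorphic functions on the tube converge absolutely. -/
def RootData.HasAutomorphicForm (D : RootData n) : Prop :=
  ∃ (m : ℕ) (κ : ℤ) (G : Subgroup (GL (Fin 2 ⊕ Fin n) ℤ)) (Φ : (Fin n → ℂ) → ℂ)
    (ε : D.W →* ℤˣ) (μ : (Fin n → ℤ) → ℤ),
    0 < m ∧ IsAutomorphicForm D.B D.u m κ G Φ ∧
    (∀ w : D.W, ∀ α ∈ D.P₀, IsReflection D.B α w → ε w = -1) ∧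
    (∀ w : D.W, ∀ α ∈ D.P₁, IsReflection D.B α w → ε w = 1) ∧
    ∀ z ∈ tube D.B D.u, ∃ a b : ℂ,
      HasSum (fun w : D.W => ((ε w : ℤ) : ℂ) * expo D.B (act w.1 D.ρ) z) a ∧
      HasSum (fun p : D.W × D.chamberVectors =>
        ((ε p.1 : ℤ) : ℂ) * ((μ p.2 : ℂ) *
          expo D.B (act p.1.1 (D.ρ + ofInt ℚ p.2.1)) z)) b ∧
      Φ z = a - b

end Automorphic

end LorentzianKM

end

/-! Since `(ρ, α) < 0` for every simple root, `ρ` and the vectors `ρ + a` are strictly dominant, so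
they have trivial stabilizers in `W` and lie in different orbits. The expansion of `Φ` is therefore
an honest Fourier series: its coefficient function `f` is `ε(w)` at `w(ρ)`, and its support lies in
the `W`-orbits of `ρ` and the `ρ + a`. Automorphisms of `S` extend to `H(m) ⊕ S` by the identity;
those landing in `G` form a finite index subgroup `H` of `O⁺(S)`, and `Φ(h z) = θ Φ(z)` with
constant `θ`. Uniqueness of Fourier coefficients turns this into `f(h l) = θ f(l)`, so `H` preserves
the support of `f` (`RootData.exists_isFourierExpansion`).

A Koecher argument shows `(ρ, V⁺) ≤ 0`, whence `ρ² ≤ 0`: otherwise a hyperbolic isometry in `H`,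
built from Pell's equation, would move `ρ` to infinitely many exponents whose terms do not decay
(`form_rho_nonpos`). This is one of the two places where rank at least 3 is used, to find a plane
with nontrivial Pell solutions.

For `g ∈ H` the exponent `gρ` lies in the support. If it were `w(ρ + a)`, comparing squares would
make `ρ` and `a` proportional and isotropic, and `ρ` a rational eigenvector of an integral
automorphism with eigenvalue greater than 1, which is impossible (`exists_eq_act`). Hence `gρ = wρ`,
and `w⁻¹g` fixes `ρ` and the support. The vectors `s_α(ρ) = ρ + α` are in the support, and dominant
vectors are maximal in their orbits, so `w⁻¹g` preserves the chamber (`act_inv_mem_C`). Thus `H ⊆ W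
· Sym(𝓜)`.

Elements of `H ∩ Sym(𝓜)` fix `ρ`; this forces them to permute `P` without rescaling, and the
coefficient `ε(s_α)` at `ρ + α` tells odd from even roots, so they lie in `Sym(P₁ ⊆ P)`. Finally the
simple roots span, because their orthogonal complement is `H`-stable and a Pell isometry rules out a
proper such subspace. So `ρ` is determined by its products with `P`, which gives (iv) and the finite
orbit. -/

namespace LorentzianKM

/-! ### Lattice vectors after extension of scalars -/

section OfInt

variable {ι : Type*} {R : Type*} [CommRing R]

@[simp] theorem ofInt_neg (x : ι → ℤ) : ofInt R (-x) = -ofInt R x := by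
  funext i; simp [ofInt]

@[simp] theorem ofInt_zero : ofInt R (0 : ι → ℤ) = 0 := by
  funext i; simp [ofInt]

theorem ofInt_injective [CharZero R] : Function.Injective (ofInt R : (ι → ℤ) → ι → R) := by
  intro x y h
  funext i
  have := congrFun h i
  simpa [ofInt] using this

theorem ofInt_eq_zero [CharZero R] {x : ι → ℤ} : ofInt R x = 0 ↔ x = 0 :=
  ⟨fun h => ofInt_injective (R := R) (by simpa using h), fun h => by simp [h]⟩

end OfInt

/-! ### The bilinear form and the action of automorphisms -/

section FormBasics

variable {ι : Type*} [Fintype ι] {R : Type*} [CommRing R] {B : Matrix ι ι ℤ}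

theorem form_add_left (x y z : ι → R) : form B (x + y) z = form B x z + form B y z := by
  simp [form, add_dotProduct]

theorem form_add_right (x y z : ι → R) : form B x (y + z) = form B x y + form B x z := by
  simp [form, mulVec_add, dotProduct_add]

theorem form_smul_left (c : R) (x y : ι → R) : form B (c • x) y = c * form B x y := by
  simp [form, smul_dotProduct]

theorem form_smul_right (c : R) (x y : ι → R) : form B x (c • y) = c * form B x y := by
  simp [form, mulVec_smul, dotProduct_smul]

theorem form_neg_left (x y : ι → R) : form B (-x) y = -form B x y := by
  simp [form, neg_dotProduct]

theorem form_neg_right (x y : ι → R) : form B x (-y) = -form B x y := by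
  simp [form, mulVec_neg, dotProduct_neg]

theorem form_sub_left (x y z : ι → R) : form B (x - y) z = form B x z - form B y z := by
  simp [form, sub_dotProduct]

theorem form_sub_right (x y z : ι → R) : form B x (y - z) = form B x y - form B x z := by
  simp [form, mulVec_sub, dotProduct_sub]

@[simp] theorem form_zero_left (x : ι → R) : form B 0 x = 0 := by simp [form]

theorem form_comm (hB : B.IsSymm) (x y : ι → R) : form B x y = form B y x := by
  have h : (B.map (Int.cast : ℤ → R))ᵀ = B.map (Int.cast : ℤ → R) := by
    rw [← Matrix.transpose_map, hB.eq]
  rw [form, form, dotProduct_mulVec, dotProduct_comm, ← Matrix.mulVec_transpose, h]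

theorem map_form {S : Type*} [CommRing S] (f : R →+* S) (x y : ι → R) :
    form B (fun i => f (x i)) (fun i => f (y i)) = f (form B x y) := by
  simp [form, dotProduct, mulVec, map_sum, map_mul]

theorem map_act [DecidableEq ι] {S : Type*} [CommRing S] (f : R →+* S) (g : GL ι ℤ) (x : ι → R) :
    act g (fun i => f (x i)) = fun i => f (act g x i) := by
  funext i
  simp [act, dotProduct, mulVec, map_sum, map_mul]

theorem form_ofInt (x y : ι → ℤ) : form B (ofInt R x) (ofInt R y) = ((form B x y : ℤ) : R) :=
  map_form (Int.castRingHom R) x y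

variable [DecidableEq ι]

theorem act_ofInt (g : GL ι ℤ) (x : ι → ℤ) : act g (ofInt R x) = ofInt R (act g x) :=
  map_act (Int.castRingHom R) g x

theorem act_add (g : GL ι ℤ) (x y : ι → R) : act g (x + y) = act g x + act g y := by
  simp [act, mulVec_add]

theorem act_sub (g : GL ι ℤ) (x y : ι → R) : act g (x - y) = act g x - act g y := by
  simp [act, mulVec_sub]

theorem act_neg (g : GL ι ℤ) (x : ι → R) : act g (-x) = -act g x := by
  simp [act, mulVec_neg]

theorem act_smul (g : GL ι ℤ) (c : R) (x : ι → R) : act g (c • x) = c • act g x := by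
  simp [act, mulVec_smul]

@[simp] theorem act_one_apply (x : ι → R) : act (1 : GL ι ℤ) x = x := by rw [act_one]; rfl

theorem act_mul_apply (g h : GL ι ℤ) (x : ι → R) : act (g * h) x = act g (act h x) := by
  rw [act_mul]; rfl

@[simp] theorem act_inv_act (g : GL ι ℤ) (x : ι → R) : act g⁻¹ (act g x) = x := by
  rw [← act_mul_apply, inv_mul_cancel, act_one_apply]

@[simp] theorem act_act_inv (g : GL ι ℤ) (x : ι → R) : act g (act g⁻¹ x) = x := by
  rw [← act_mul_apply, mul_inv_cancel, act_one_apply]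

theorem act_injective (g : GL ι ℤ) : Function.Injective (act (R := R) g) :=
  Function.LeftInverse.injective (act_inv_act g)

theorem form_act {g : GL ι ℤ} (hg : g ∈ orthGroup B) (x y : ι → R) :
    form B (act g x) (act g y) = form B x y := by
  have hg' : g.valᵀ * B * g.val = B := hg
  have h : (g.val.map (Int.cast : ℤ → R))ᵀ * B.map (Int.cast : ℤ → R) *
      g.val.map (Int.cast : ℤ → R) = B.map (Int.cast : ℤ → R) := by
    conv_rhs => rw [← hg']
    have e := Matrix.map_mul (f := Int.castRingHom R) (L := g.valᵀ * B) (M := g.val)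
    have e' := Matrix.map_mul (f := Int.castRingHom R) (L := g.valᵀ) (M := B)
    simp only [Int.coe_castRingHom] at e e'
    rw [e, e', Matrix.transpose_map]
  rw [form, form, act, act, ← Matrix.vecMul_transpose, ← dotProduct_mulVec, mulVec_mulVec,
    mulVec_mulVec, h]

theorem form_act_left {g : GL ι ℤ} (hg : g ∈ orthGroup B) (x y : ι → R) :
    form B (act g x) y = form B x (act g⁻¹ y) := by
  rw [← form_act hg x, act_act_inv]

theorem form_act_right {g : GL ι ℤ} (hg : g ∈ orthGroup B) (x y : ι → R) :
    form B x (act g y) = form B (act g⁻¹ x) y := by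
  rw [← form_act hg _ y, act_act_inv]

theorem mem_orthGroup_of_form {g : GL ι ℤ}
    (h : ∀ x y : ι → ℤ, form B (act g x) (act g y) = form B x y) : g ∈ orthGroup B := by
  change g.valᵀ * B * g.val = B
  ext i j
  have := h (Pi.single i 1) (Pi.single j 1)
  have e : ∀ M : Matrix ι ι ℤ, M.map (Int.cast : ℤ → ℤ) = M := fun M => by ext; simp
  simp only [form, act, e] at this
  rw [← Matrix.vecMul_transpose, ← dotProduct_mulVec, mulVec_mulVec, mulVec_mulVec] at this
  simpa using this

theorem mem_setStab_iff {X : Set (ι → R)} {g : GL ι ℤ} :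
    g ∈ setStab X ↔ act g '' X = X := Iff.rfl

theorem act_mem_of_mem_setStab {X : Set (ι → R)} {g : GL ι ℤ} (hg : g ∈ setStab X) {x : ι → R}
    (hx : x ∈ X) : act g x ∈ X := by
  rw [mem_setStab_iff] at hg
  rw [← hg]; exact mem_image_of_mem _ hx

theorem mem_setStab_of_forall {X : Set (ι → R)} {g : GL ι ℤ} (h : ∀ x ∈ X, act g x ∈ X)
    (h' : ∀ x ∈ X, act g⁻¹ x ∈ X) : g ∈ setStab X := by
  rw [mem_setStab_iff]
  apply Subset.antisymm
  · rintro _ ⟨x, hx, rfl⟩; exact h x hx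
  · intro x hx; exact ⟨_, h' x hx, act_act_inv g x⟩

end FormBasics

/-! ### Lorentzian geometry and local finiteness of mirrors -/

section Lorentz

open Topology Filter

variable {ι : Type*} [Fintype ι] {B : Matrix ι ι ℤ} {u : ι → ℝ}

theorem continuous_form : Continuous fun p : (ι → ℝ) × (ι → ℝ) => form B p.1 p.2 := by
  unfold form dotProduct mulVec dotProduct
  fun_prop

theorem Continuous.form {X : Type*} [TopologicalSpace X] {f g : X → ι → ℝ} (hf : Continuous f)
    (hg : Continuous g) : Continuous fun x => form B (f x) (g x) :=
  continuous_form.comp (hf.prodMk hg)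

theorem isOpen_posCone : IsOpen (posCone B u) :=
  (isOpen_lt (Continuous.form continuous_id continuous_id) continuous_const).inter
    (isOpen_lt (Continuous.form continuous_id continuous_const) continuous_const)

/-- The definition supplies positivity only on the complement of one vector `u₀`; here `u` is any
vector of negative square. If `x² ≤ 0`, the combination of `u` and `x` orthogonal to `u₀` has
nonpositive square, so it vanishes, and then `x` itself is orthogonal to `u₀`. -/
theorem IsHyperbolic.form_pos (hB : IsHyperbolic B) (hu : form B u u < 0) {x : ι → ℝ}
    (hxu : form B x u = 0) (hx : x ≠ 0) : 0 < form B x x := by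
  obtain ⟨hs, u₀, -, h₀⟩ := hB
  by_contra! hle
  have hxu' : form B u x = 0 := by rw [form_comm hs, hxu]
  have e1 : form B (form B x u₀ • u - form B u u₀ • x) u₀ = 0 := by
    rw [form_sub_left, form_smul_left, form_smul_left]; ring
  have e2 : form B (form B x u₀ • u - form B u u₀ • x) (form B x u₀ • u - form B u u₀ • x) =
      form B x u₀ ^ 2 * form B u u + form B u u₀ ^ 2 * form B x x := by
    simp only [form_sub_left, form_sub_right, form_smul_left, form_smul_right, hxu, hxu']; ring
  have h1 : form B x u₀ ^ 2 * form B u u ≤ 0 := mul_nonpos_of_nonneg_of_nonpos (sq_nonneg _) hu.le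
  have h2 : form B u u₀ ^ 2 * form B x x ≤ 0 := mul_nonpos_of_nonneg_of_nonpos (sq_nonneg _) hle
  have e3 : form B x u₀ • u - form B u u₀ • x = 0 := by
    by_contra hne
    have := h₀ _ e1 hne
    linarith
  rw [e3, form_zero_left] at e2
  have e4 : form B x u₀ ^ 2 * form B u u = 0 := by linarith
  have e5 : form B x u₀ = 0 := by
    rcases mul_eq_zero.1 e4 with h | h
    · exact pow_eq_zero_iff two_ne_zero |>.1 h
    · exact absurd h hu.ne
  exact absurd (h₀ x e5 hx) (not_lt.2 hle)

theorem IsHyperbolic.form_nonneg (hB : IsHyperbolic B) (hu : form B u u < 0) {x : ι → ℝ}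
    (hxu : form B x u = 0) : 0 ≤ form B x x := by
  rcases eq_or_ne x 0 with rfl | hx
  · simp
  · exact (hB.form_pos hu hxu hx).le

theorem IsHyperbolic.eq_zero_of_forall (hB : IsHyperbolic B) {x : ι → ℝ}
    (h : ∀ y, form B x y = 0) : x = 0 := by
  obtain ⟨-, u₀, -, h₀⟩ := hB
  by_contra hx
  exact (h₀ x (h u₀) hx).ne' (h x)

theorem self_mem_posCone (hu : form B u u < 0) : u ∈ posCone B u := ⟨hu, hu⟩

/-- Any two vectors of the same half cone have negative product: the combination of `x` and `y`
orthogonal to `u` must have nonnegative square. -/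
theorem IsHyperbolic.form_neg_of_mem (hB : IsHyperbolic B) (hu : form B u u < 0) {x y : ι → ℝ}
    (hx : x ∈ posCone B u) (hy : y ∈ posCone B u) : form B x y < 0 := by
  obtain ⟨hx1, hx2⟩ := hx
  obtain ⟨hy1, hy2⟩ := hy
  by_contra! hle
  have e1 : form B (form B y u • x - form B x u • y) u = 0 := by
    rw [form_sub_left, form_smul_left, form_smul_left]; ring
  have e2 := hB.form_nonneg hu e1
  simp only [form_sub_left, form_sub_right, form_smul_left, form_smul_right,
    form_comm hB.1 y x] at e2
  have h1 : form B y u ^ 2 * form B x x < 0 := mul_neg_of_pos_of_neg (pow_two_pos_of_ne_zero hy2.ne) hx1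
  have h2 : form B x u ^ 2 * form B y y < 0 := mul_neg_of_pos_of_neg (pow_two_pos_of_ne_zero hx2.ne) hy1
  have h3 : 0 ≤ form B x u * form B y u * form B x y :=
    mul_nonneg (mul_pos_of_neg_of_neg hx2 hy2).le hle
  nlinarith

theorem IsHyperbolic.mem_posCone (hB : IsHyperbolic B) (hu : form B u u < 0) {x y : ι → ℝ}
    (hx : x ∈ posCone B u) (hy : form B y y < 0) (hxy : form B y x < 0) : y ∈ posCone B u := by
  refine ⟨hy, ?_⟩
  by_contra! hle
  rcases hle.eq_or_lt with h | h
  · exact absurd (hB.form_nonneg hu h.symm) (not_le.2 hy)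
  · have : -y ∈ posCone B u := ⟨by simpa [form_neg_left, form_neg_right] using hy,
      by simpa [form_neg_left] using h⟩
    have := hB.form_neg_of_mem hu this hx
    rw [form_neg_left] at this
    linarith

theorem smul_mem_posCone {x : ι → ℝ} (hx : x ∈ posCone B u) {c : ℝ} (hc : 0 < c) :
    c • x ∈ posCone B u := by
  obtain ⟨h1, h2⟩ := hx
  refine ⟨?_, ?_⟩
  · rw [form_smul_left, form_smul_right, ← mul_assoc]
    exact mul_neg_of_pos_of_neg (mul_pos hc hc) h1
  · rw [form_smul_left]; exact mul_neg_of_pos_of_neg hc h2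

theorem IsHyperbolic.add_mem_posCone (hB : IsHyperbolic B) (hu : form B u u < 0) {x y : ι → ℝ}
    (hx : x ∈ posCone B u) (hy : y ∈ posCone B u) : x + y ∈ posCone B u := by
  have h := hB.form_neg_of_mem hu hx hy
  refine ⟨?_, ?_⟩
  · rw [form_add_left, form_add_right, form_add_right, form_comm hB.1 y x]
    linarith [hx.1, hy.1]
  · rw [form_add_left]; linarith [hx.2, hy.2]

theorem form_nonpos_of_mem_closure {x y : ι → ℝ} (hx : x ∈ closure (posCone B u))
    (h : ∀ z ∈ posCone B u, form B z y ≤ 0) : form B x y ≤ 0 :=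
  closure_minimal (t := {z | form B z y ≤ 0}) h
    (isClosed_le (Continuous.form continuous_id continuous_const) continuous_const) hx

theorem form_self_nonpos_of_mem_closure {x : ι → ℝ} (hx : x ∈ closure (posCone B u)) :
    form B x x ≤ 0 :=
  closure_minimal (t := {z | form B z z ≤ 0}) (fun _ hz => hz.1.le)
    (isClosed_le (Continuous.form continuous_id continuous_id) continuous_const) hx

/-- The positive definite form attached to a vector of negative square bounds the norm. -/
theorem IsHyperbolic.exists_majorant (hB : IsHyperbolic B) (hu : form B u u < 0) :
    ∃ δ > 0, ∀ y : ι → ℝ, δ * ‖y‖ ^ 2 ≤ form B y y - 2 * form B y u ^ 2 / form B u u := by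
  have hpos : ∀ y : ι → ℝ, y ≠ 0 → 0 < form B y y - 2 * form B y u ^ 2 / form B u u := by
    intro y hy
    by_cases hyu : form B y u = 0
    · simpa [hyu] using hB.form_pos hu hyu hy
    · have e1 : form B (y - (form B y u / form B u u) • u) u = 0 := by
        rw [form_sub_left, form_smul_left]; field_simp [hu.ne]; ring
      have e2 := hB.form_nonneg hu e1
      simp only [form_sub_left, form_sub_right, form_smul_left, form_smul_right,
        form_comm hB.1 u y] at e2
      have e3 : form B y u / form B u u * (form B y u / form B u u * form B u u) =
        form B y u ^ 2 / form B u u := by field_simp [hu.ne]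
      have e4 : form B y u ^ 2 / form B u u < 0 := div_neg_of_pos_of_neg (by positivity) hu
      have e5 : form B y u / form B u u * form B y u = form B y u ^ 2 / form B u u := by ring
      rw [e5, mul_sub, e3, e5] at e2
      rw [mul_div_assoc]
      linarith
  -- A positive continuous function has a positive minimum on the unit sphere; homogeneity of degree
  -- 2 does the rest. The sphere is empty only in rank 0.
  have hcont : Continuous fun y : ι → ℝ => form B y y - 2 * form B y u ^ 2 / form B u u :=
    (Continuous.form continuous_id continuous_id).sub
      ((continuous_const.mul ((Continuous.form continuous_id continuous_const).pow 2)).div_const _)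
  rcases (Metric.sphere (0 : ι → ℝ) 1).eq_empty_or_nonempty with he | hne
  · refine ⟨1, one_pos, fun y => ?_⟩
    have hy : y = 0 := by
      by_contra hy
      have : (‖y‖⁻¹ • y) ∈ Metric.sphere (0 : ι → ℝ) 1 := by
        simp [norm_smul, inv_mul_cancel₀ (norm_ne_zero_iff.2 hy)]
      rw [he] at this; exact this
    simp [hy]
  · obtain ⟨y₀, hy₀, hmin⟩ := (isCompact_sphere (0 : ι → ℝ) 1).exists_isMinOn hne
      hcont.continuousOn
    have hy₀' : y₀ ≠ 0 := by rintro rfl; simp at hy₀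
    refine ⟨_, hpos y₀ hy₀', fun y => ?_⟩
    rcases eq_or_ne y 0 with rfl | hy
    · simp
    · have hn : ‖y‖ ≠ 0 := norm_ne_zero_iff.2 hy
      have hm : (‖y‖⁻¹ • y) ∈ Metric.sphere (0 : ι → ℝ) 1 := by
        simp [norm_smul, inv_mul_cancel₀ hn]
      have h := hmin hm
      simp only [mem_ofPred_eq, form_smul_left, form_smul_right] at h
      have hn2 : 0 ≤ ‖y‖ ^ 2 := by positivity
      have h2 := mul_le_mul_of_nonneg_right h hn2
      refine h2.trans (le_of_eq ?_)
      field_simp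

theorem finite_norm_le (C : ℝ) : {β : ι → ℤ | ‖ofInt ℝ β‖ ≤ C}.Finite := by
  classical
  refine (Set.finite_Icc (fun _ : ι => -⌈C⌉) (fun _ => ⌈C⌉)).subset fun β hβ => ?_
  have h : ∀ i, |(β i : ℝ)| ≤ C := fun i => (norm_le_pi_norm (ofInt ℝ β) i).trans hβ
  refine ⟨fun i => ?_, fun i => ?_⟩
  · have h1 := (abs_le.1 (h i)).1
    have h2 := Int.le_ceil C
    have : (-⌈C⌉ : ℝ) ≤ (β i : ℝ) := by linarith
    exact_mod_cast this
  · have h1 := (abs_le.1 (h i)).2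
    have h2 := Int.le_ceil C
    have : (β i : ℝ) ≤ (⌈C⌉ : ℝ) := by linarith
    exact_mod_cast this

/-- The two bounds together bound the positive definite majorant attached to `x`. -/
theorem IsHyperbolic.finite_form_le (hB : IsHyperbolic B) {x : ι → ℝ} (hx : form B x x < 0)
    (c C : ℝ) : {β : ι → ℤ | form B (ofInt ℝ β) (ofInt ℝ β) ≤ c ∧
      |form B (ofInt ℝ β) x| ≤ C}.Finite := by
  obtain ⟨δ, hδ, h⟩ := hB.exists_majorant hx
  refine (finite_norm_le (ι := ι) (Real.sqrt ((c - 2 * C ^ 2 / form B x x) / δ))).subset ?_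
  rintro β ⟨h1, h2⟩
  apply Real.le_sqrt_of_sq_le
  rw [le_div_iff₀' hδ]
  refine (h _).trans ?_
  have h3 : form B (ofInt ℝ β) x ^ 2 ≤ C ^ 2 := sq_le_sq' (abs_le.1 h2).1 (abs_le.1 h2).2
  have h4 : 2 * C ^ 2 / form B x x ≤ 2 * form B (ofInt ℝ β) x ^ 2 / form B x x :=
    div_le_div_of_nonpos_of_le hx.le (by linarith)
  linarith

variable [DecidableEq ι]

theorem IsHyperbolic.det_ne_zero (hB : IsHyperbolic B) : B.det ≠ 0 := by
  intro h
  obtain ⟨v, hv, hv'⟩ := Matrix.exists_mulVec_eq_zero_iff.2 h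
  have hz : ∀ y : ι → ℝ, form B (ofInt ℝ v) y = 0 := by
    intro y
    rw [form_comm hB.1, form]
    have : B.map (Int.cast : ℤ → ℝ) *ᵥ ofInt ℝ v = 0 := by
      have e := RingHom.map_mulVec (Int.castRingHom ℝ) B v
      funext i
      have := e i
      rw [hv'] at this
      exact this.symm.trans (by simp)
    rw [this, dotProduct_zero]
  exact hv (ofInt_eq_zero.1 (hB.eq_zero_of_forall hz))

/-- Roots have bounded square, which makes the mirrors locally finite. Write `β = kγ` with `γ`
primitive. Since `β²` divides `2Bβ`, multiplying by the adjugate shows that `β²` divides `2 det(B)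
β`; cancelling `k` and the content of `γ` gives `kγ² ∣ 2 det B`, and `β² = k²γ² ≤ (kγ²)²`. -/
theorem IsHyperbolic.root_norm_le (hB : IsHyperbolic B) {β : ι → ℤ} (hβ : IsRoot B β) :
    form B β β ≤ (2 * B.det) ^ 2 := by
  obtain ⟨hpos, hdvd⟩ := hβ
  have hne : ∃ i, β i ≠ 0 := by
    by_contra! h
    rw [show β = 0 from funext h] at hpos
    simp at hpos
  obtain ⟨i₀, hi₀⟩ := hne
  obtain ⟨γ, hγ, hg⟩ := Finset.extract_gcd β (s := Finset.univ) ⟨i₀, Finset.mem_univ _⟩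
  set k := Finset.univ.gcd β with hk
  have hk0 : k ≠ 0 := by
    intro h0
    have := hγ i₀ (Finset.mem_univ _)
    rw [h0, zero_mul] at this
    exact hi₀ this
  have hβγ : β = k • γ := by funext i; simpa using hγ i (Finset.mem_univ i)
  have h1 : ∀ i, form B β β ∣ 2 * (B *ᵥ β) i := by
    intro i
    have := hdvd (Pi.single i 1)
    rw [form_comm hB.1 β (Pi.single i 1)] at this
    have e : B.map (Int.cast : ℤ → ℤ) = B := by ext; simp
    conv_rhs at this => rw [form]
    rw [e] at this
    simpa using this
  have h2 : ∀ i, form B β β ∣ 2 * B.det * β i := by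
    intro i
    have e : (B.adjugate *ᵥ (B *ᵥ β)) i = B.det * β i := by
      rw [mulVec_mulVec, adjugate_mul, smul_mulVec, one_mulVec]; rfl
    rw [mul_assoc, ← e, mulVec, dotProduct, Finset.mul_sum]
    refine Finset.dvd_sum fun j _ => ?_
    have := (h1 j).mul_left (B.adjugate i j)
    rwa [mul_left_comm] at this
  have h3 : form B β β = k * (k * form B γ γ) := by
    rw [hβγ, form_smul_left, form_smul_right]
  have h4 : ∀ i, k * form B γ γ ∣ 2 * B.det * γ i := by
    intro i
    have := h2 i
    rw [h3, hβγ, Pi.smul_apply, smul_eq_mul, mul_left_comm (2 * B.det)] at this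
    exact (mul_dvd_mul_iff_left hk0).1 this
  have h5 : k * form B γ γ ∣ 2 * B.det := by
    have : k * form B γ γ ∣ Finset.univ.gcd fun i => 2 * B.det * γ i :=
      Finset.dvd_gcd fun i _ => h4 i
    rw [Finset.gcd_mul_left, hg, mul_one] at this
    exact (dvd_normalize_iff).1 this
  have h6 : |k * form B γ γ| ≤ |2 * B.det| :=
    Int.le_of_dvd (abs_pos.2 (mul_ne_zero two_ne_zero hB.det_ne_zero)) ((abs_dvd_abs _ _).2 h5)
  have h7 : 0 < form B γ γ := by
    rw [h3, ← mul_assoc] at hpos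
    exact pos_of_mul_pos_right hpos (mul_self_nonneg k)
  calc form B β β ≤ (k * form B γ γ) ^ 2 := by
        rw [h3]
        nlinarith [mul_pos (mul_self_pos.2 hk0) h7]
    _ ≤ (2 * B.det) ^ 2 := sq_le_sq.2 h6

/-- Near a vector of negative square, no root changes its sign. -/
theorem IsHyperbolic.eventually_root_sign (hB : IsHyperbolic B) {y : ι → ℝ}
    (hy : form B y y < 0) : ∀ᶠ x in 𝓝 y, ∀ β : ι → ℤ, IsRoot B β →
      form B y (ofInt ℝ β) ≠ 0 → 0 < form B y (ofInt ℝ β) * form B x (ofInt ℝ β) := by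
  set c : ℝ := (2 * (B.det : ℝ)) ^ 2 with hc
  have hnorm : ∀ β : ι → ℤ, IsRoot B β → form B (ofInt ℝ β) (ofInt ℝ β) ≤ c := by
    intro β hβ
    rw [form_ofInt, hc]
    exact_mod_cast hB.root_norm_le hβ
  obtain ⟨δ, hδ, hmaj⟩ := hB.exists_majorant hy
  have hc0 : 0 ≤ c := sq_nonneg _
  set κ : ℝ := (c - 2 / form B y y) / δ with hκ
  have hκ0 : 0 ≤ κ := div_nonneg (by
    have : 2 / form B y y < 0 := div_neg_of_pos_of_neg two_pos hy
    linarith) hδ.le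
  -- Roots with `|(y, β)| ≥ 1` have norm at most a constant times `|(y, β)|`, so one neighbourhood
  -- of `y` serves all of them. The remaining roots are finite in number.
  have hbig : ∀ β : ι → ℤ, IsRoot B β → 1 ≤ |form B y (ofInt ℝ β)| →
      ‖ofInt ℝ β‖ ≤ Real.sqrt κ * |form B y (ofInt ℝ β)| := by
    intro β hβ h1
    have h2 := hmaj (ofInt ℝ β)
    have h3 := hnorm β hβ
    rw [form_comm hB.1 _ y] at h2
    set t := form B y (ofInt ℝ β)
    have h4 : 1 ≤ t ^ 2 := by rw [← sq_abs]; nlinarith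
    rw [← Real.sqrt_sq_eq_abs, ← Real.sqrt_mul hκ0]
    apply Real.le_sqrt_of_sq_le
    rw [hκ, div_mul_eq_mul_div, le_div_iff₀' hδ]
    refine h2.trans ?_
    have : 2 * t ^ 2 / form B y y = 2 / form B y y * t ^ 2 := by ring
    rw [this]
    nlinarith
  have hfin := hB.finite_form_le hy c 1
  have hsmall : ∀ᶠ x in 𝓝 y, ∀ β ∈ {β : ι → ℤ | form B (ofInt ℝ β) (ofInt ℝ β) ≤ c ∧
      |form B (ofInt ℝ β) y| ≤ 1}, form B y (ofInt ℝ β) ≠ 0 →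
      0 < form B y (ofInt ℝ β) * form B x (ofInt ℝ β) := by
    rw [eventually_all_finite hfin]
    intro β _
    by_cases h0 : form B y (ofInt ℝ β) = 0
    · simp [h0]
    · have hcont : Continuous fun x => form B y (ofInt ℝ β) * form B x (ofInt ℝ β) :=
        continuous_const.mul (Continuous.form continuous_id continuous_const)
      have := hcont.tendsto y |>.eventually (lt_mem_nhds (mul_self_pos.2 h0))
      filter_upwards [this] with x hx _ using hx
  have hbound : ∀ᶠ x in 𝓝 y, ∀ v : ι → ℝ, |form B (x - y) v| * (Real.sqrt κ + 1) ≤ ‖v‖ / 2 := by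
    set f : (ι → ℝ) → ℝ := fun x =>
      (∑ i, |x i - y i| * ∑ j, |(B i j : ℝ)|) * (Real.sqrt κ + 1) with hf
    have hcont : Continuous f := by rw [hf]; fun_prop
    have h0 : f y < 1 / 2 := by simp [hf]
    filter_upwards [hcont.tendsto y |>.eventually (gt_mem_nhds h0)] with x hx v
    have h1 : |form B (x - y) v| ≤ (∑ i, |x i - y i| * ∑ j, |(B i j : ℝ)|) * ‖v‖ := by
      rw [form, dotProduct, Finset.sum_mul]
      refine (Finset.abs_sum_le_sum_abs _ _).trans (Finset.sum_le_sum fun i _ => ?_)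
      rw [abs_mul, mul_assoc]
      refine mul_le_mul_of_nonneg_left ?_ (abs_nonneg _)
      rw [mulVec, dotProduct, Finset.sum_mul]
      refine (Finset.abs_sum_le_sum_abs _ _).trans (Finset.sum_le_sum fun j _ => ?_)
      rw [abs_mul, Matrix.map_apply]
      exact mul_le_mul_of_nonneg_left (norm_le_pi_norm v j) (abs_nonneg _)
    have h2 : 0 ≤ Real.sqrt κ + 1 := by positivity
    calc _ ≤ (∑ i, |x i - y i| * ∑ j, |(B i j : ℝ)|) * ‖v‖ * (Real.sqrt κ + 1) :=
          mul_le_mul_of_nonneg_right h1 h2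
      _ = f x * ‖v‖ := by rw [hf]; ring
      _ ≤ 1 / 2 * ‖v‖ := mul_le_mul_of_nonneg_right hx.le (norm_nonneg _)
      _ = ‖v‖ / 2 := by ring
  filter_upwards [hsmall, hbound] with x hx1 hx2 β hβ h0
  by_cases h1 : |form B y (ofInt ℝ β)| ≤ 1
  · exact hx1 β ⟨hnorm β hβ, by rwa [form_comm hB.1]⟩ h0
  · push Not at h1
    have h2 := hbig β hβ h1.le
    have h3 := hx2 (ofInt ℝ β)
    rw [form_sub_left] at h3
    set t := form B y (ofInt ℝ β)
    set s := form B x (ofInt ℝ β)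
    have h5 : |s - t| * (Real.sqrt κ + 1) < |t| * (Real.sqrt κ + 1) := by
      have : 0 ≤ Real.sqrt κ := Real.sqrt_nonneg _
      nlinarith [abs_nonneg t]
    have h6 : |s - t| < |t| := lt_of_mul_lt_mul_right h5 (by positivity)
    have h7 : (s - t) ^ 2 < t ^ 2 := sq_lt_sq.2 h6
    nlinarith [sq_nonneg s]

end Lorentz

/-! ### Reflections and roots -/

section Reflections

variable {ι : Type*} [Fintype ι] {B : Matrix ι ι ℤ} {u : ι → ℝ}

theorem IsRoot.form_pos {α : ι → ℤ} {K : Type*} [Field K] [LinearOrder K] [IsStrictOrderedRing K]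
    (h : IsRoot B α) : 0 < form B (ofInt K α) (ofInt K α) := by
  rw [form_ofInt]; exact_mod_cast h.1

variable [DecidableEq ι]

/-- Both sides are linear and agree on the standard basis, which is rational. -/
theorem IsReflection.act_eq {K : Type*} [Field K] [CharZero K] {α : ι → ℤ} {s : GL ι ℤ}
    (h : IsReflection B α s) (x : ι → K) : act s x =
      x - (2 * form B x (ofInt K α) / form B (ofInt K α) (ofInt K α)) • ofInt K α := by
  let L : (ι → K) →ₗ[K] (ι → K) :=
    { toFun := act s, map_add' := act_add s, map_smul' := fun c x => act_smul s c x }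
  let L' : (ι → K) →ₗ[K] (ι → K) :=
    { toFun := fun x =>
        x - (2 * form B x (ofInt K α) / form B (ofInt K α) (ofInt K α)) • ofInt K α
      map_add' := fun x y => by
        rw [form_add_left, mul_add, add_div, add_smul]; abel
      map_smul' := fun c x => by
        rw [form_smul_left, mul_left_comm, mul_div_assoc, mul_smul, smul_sub]; rfl }
  have hL : L = L' := by
    refine LinearMap.pi_ext' fun i => LinearMap.ext_ring ?_
    have e : (Pi.single i 1 : ι → K) = fun j => Rat.castHom K ((Pi.single i 1 : ι → ℚ) j) := by
      funext j
      by_cases hj : j = i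
      · subst hj; simp
      · simp [hj]
    have ha : ofInt K α = fun j => Rat.castHom K (ofInt ℚ α j) := by funext j; simp [ofInt]
    change act s (Pi.single i 1 : ι → K) = (Pi.single i 1 : ι → K) -
      (2 * form B (Pi.single i 1 : ι → K) (ofInt K α) / form B (ofInt K α) (ofInt K α)) •
        ofInt K α
    rw [e, map_act, h, ha, map_form, map_form]
    funext j
    simp
  exact congrArg (fun f => f x) hL

theorem isReflection_of_real {α : ι → ℤ} {s : GL ι ℤ} (h : ∀ x : ι → ℝ, act s x =
      x - (2 * form B x (ofInt ℝ α) / form B (ofInt ℝ α) (ofInt ℝ α)) • ofInt ℝ α) :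
    IsReflection B α s := by
  intro x
  have ha : ofInt ℝ α = fun j => Rat.castHom ℝ (ofInt ℚ α j) := by funext j; simp [ofInt]
  have := h fun j => Rat.castHom ℝ (x j)
  rw [map_act, ha, map_form, map_form] at this
  funext j
  have := congrFun this j
  apply (Rat.castHom ℝ).injective
  rw [this]
  simp

theorem gl_ext_real {g h : GL ι ℤ} (H : ∀ x : ι → ℝ, act g x = act h x) : g = h := by
  ext i j
  have := congrFun (H (Pi.single j 1)) i
  simpa [act] using this

theorem IsReflection.unique {α : ι → ℤ} {s t : GL ι ℤ} (hs : IsReflection B α s)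
    (ht : IsReflection B α t) : s = t :=
  gl_ext_real fun x => by rw [hs.act_eq, ht.act_eq]

theorem IsReflection.of_smul {α β : ι → ℤ} {s : GL ι ℤ} (hs : IsReflection B β s) {c : ℝ}
    (hc : c ≠ 0) (h : ofInt ℝ α = c • ofInt ℝ β) : IsReflection B α s := by
  refine isReflection_of_real fun x => ?_
  rw [hs.act_eq, h, form_smul_right, form_smul_left, form_smul_right, smul_smul]
  congr 2
  by_cases h0 : form B (ofInt ℝ β) (ofInt ℝ β) = 0
  · simp [h0]
  · field_simp

theorem IsReflection.conj {α : ι → ℤ} {s g : GL ι ℤ} (hs : IsReflection B α s)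
    (hg : g ∈ orthGroup B) : IsReflection B (act g α) (g * s * g⁻¹) := by
  refine isReflection_of_real fun x => ?_
  rw [act_mul_apply, act_mul_apply, hs.act_eq, act_sub, act_smul, act_act_inv, ← act_ofInt,
    form_act hg, form_act_right hg]

variable {α : ι → ℤ} {s : GL ι ℤ}

theorem IsReflection.act_self {K : Type*} [Field K] [LinearOrder K] [IsStrictOrderedRing K]
    (hs : IsReflection B α s) (h : IsRoot B α) : act s (ofInt K α) = -ofInt K α := by
  rw [hs.act_eq, mul_div_assoc, div_self (h.form_pos).ne', mul_one, two_smul]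
  abel

theorem IsReflection.mul_self (hs : IsReflection B α s) (h : IsRoot B α) : s * s = 1 := by
  refine gl_ext_real fun x => ?_
  rw [act_mul_apply, hs.act_eq x, act_sub, act_smul, hs.act_self h, hs.act_eq x, act_one_apply]
  simp

theorem IsReflection.inv_eq (hs : IsReflection B α s) (h : IsRoot B α) : s⁻¹ = s :=
  inv_eq_of_mul_eq_one_right (hs.mul_self h)

theorem IsReflection.mem_orthGroup (hB : B.IsSymm) (hs : IsReflection B α s) (h : IsRoot B α) :
    s ∈ orthGroup B := by
  refine mem_orthGroup_of_form fun x y => ?_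
  have h0 := (h.form_pos (K := ℝ)).ne'
  have : form B (ofInt ℝ (act s x)) (ofInt ℝ (act s y)) = form B (ofInt ℝ x) (ofInt ℝ y) := by
    rw [← act_ofInt, ← act_ofInt, hs.act_eq, hs.act_eq]
    simp only [form_sub_left, form_sub_right, form_smul_left, form_smul_right,
      form_comm hB (ofInt ℝ α) (ofInt ℝ y)]
    field_simp
    ring
  rw [form_ofInt, form_ofInt] at this
  exact_mod_cast this

theorem IsReflection.mem_orthPlus (hB : IsHyperbolic B) (hu : form B u u < 0)
    (hs : IsReflection B α s) (h : IsRoot B α) : s ∈ orthPlus B u := by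
  have ho := hs.mem_orthGroup hB.1 h
  have hp : ∀ x ∈ posCone B u, act s x ∈ posCone B u := by
    intro x hx
    refine hB.mem_posCone hu hx (by rw [form_act ho]; exact hx.1) ?_
    -- `(s x, x) = x² - 2 (x, α)² / α²` is negative.
    rw [hs.act_eq, form_sub_left, form_smul_left, form_comm hB.1 (ofInt ℝ α) x,
      div_mul_eq_mul_div]
    have : 0 ≤ 2 * form B x (ofInt ℝ α) * form B x (ofInt ℝ α) /
        form B (ofInt ℝ α) (ofInt ℝ α) :=
      div_nonneg (by nlinarith [mul_self_nonneg (form B x (ofInt ℝ α))]) (h.form_pos).le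
    linarith [hx.1]
  refine ⟨ho, mem_setStab_of_forall hp ?_⟩
  rw [hs.inv_eq h]
  exact hp

theorem orthPlus_le : orthPlus B u ≤ orthGroup B := inf_le_left

theorem act_mem_posCone {g : GL ι ℤ} (hg : g ∈ orthPlus B u) {x : ι → ℝ}
    (hx : x ∈ posCone B u) : act g x ∈ posCone B u := act_mem_of_mem_setStab hg.2 hx

theorem IsReflectionGroup.le_orthPlus (hB : IsHyperbolic B) (hu : form B u u < 0)
    {W : Subgroup (GL ι ℤ)} (hW : IsReflectionGroup B W) : W ≤ orthPlus B u := by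
  obtain ⟨R, hR, rfl⟩ := hW
  rw [Subgroup.closure_le]
  rintro s ⟨α, hα, hs⟩
  exact hs.mem_orthPlus hB hu (hR α hα)

theorem IsRoot.act {g : GL ι ℤ} (h : IsRoot B α) (hg : g ∈ orthGroup B) : IsRoot B (act g α) :=
  ⟨by rw [form_act hg]; exact h.1, fun x => by
    rw [form_act hg, form_act_left hg]; exact h.2 _⟩

theorem act_mem_rootsOf {W : Subgroup (GL ι ℤ)} (hW : W ≤ orthGroup B) {w : GL ι ℤ} (hw : w ∈ W)
    {β : ι → ℤ} (hβ : β ∈ rootsOf B W) : act w β ∈ rootsOf B W := by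
  obtain ⟨h, s, hs, hr⟩ := hβ
  exact ⟨h.act (hW hw), _, W.mul_mem (W.mul_mem hw hs) (W.inv_mem hw), hr.conj (hW hw)⟩

theorem neg_mem_rootsOf {W : Subgroup (GL ι ℤ)} {β : ι → ℤ} (hβ : β ∈ rootsOf B W) :
    -β ∈ rootsOf B W := by
  obtain ⟨h, s, hs, hr⟩ := hβ
  refine ⟨⟨by simpa [form_neg_left, form_neg_right] using h.1, fun x => by
    simpa [form_neg_left, form_neg_right] using h.2 x⟩, s, hs, hr.of_smul (c := -1) (by norm_num) (by simp)⟩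

end Reflections

/-! ### Walls of the fundamental chamber -/

section Chamber

open Topology Filter

variable {n : ℕ} (D : RootData n)

theorem RootData.P_eq : D.P = D.P₀ ∪ D.P₁ := rfl

theorem RootData.W_le : D.W ≤ orthPlus D.B D.u := D.W_refl.le_orthPlus D.hyperbolic D.u_neg

theorem RootData.W_le_orth : D.W ≤ orthGroup D.B := D.W_le.trans orthPlus_le

variable {D}

theorem RootData.mem_C {x : Fin n → ℝ} : x ∈ D.C ↔ x ∈ posCone D.B D.u ∧
    ∀ α ∈ D.P, form D.B x (ofInt ℝ α) ≤ 0 := by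
  rw [D.C_eq]; rfl

variable (D) in
/-- A point of the chamber on none of the mirrors. -/
structure RootData.IsBasePoint (x₀ : Fin n → ℝ) : Prop where
  mem : x₀ ∈ posCone D.B D.u
  ne_zero : ∀ β ∈ rootsOf D.B D.W, form D.B x₀ (ofInt ℝ β) ≠ 0
  C_eq : D.C = {x ∈ posCone D.B D.u |
    ∀ β ∈ rootsOf D.B D.W, 0 ≤ form D.B x₀ (ofInt ℝ β) * form D.B x (ofInt ℝ β)}

variable (D) in
theorem RootData.exists_basePoint : ∃ x₀, D.IsBasePoint x₀ := by
  obtain ⟨x₀, h1, h2, h3⟩ := D.C_chamber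
  exact ⟨x₀, h1, h2, h3⟩

variable {x₀ : Fin n → ℝ}

theorem RootData.IsBasePoint.mem_C (h : D.IsBasePoint x₀) : x₀ ∈ D.C := by
  rw [h.C_eq]; exact ⟨h.mem, fun β _ => mul_self_nonneg _⟩

theorem RootData.IsBasePoint.eventually_mem_C (h : D.IsBasePoint x₀) : ∀ᶠ x in 𝓝 x₀, x ∈ D.C := by
  filter_upwards [isOpen_posCone.mem_nhds h.mem, D.hyperbolic.eventually_root_sign h.mem.1]
    with x hx1 hx2
  rw [h.C_eq]
  exact ⟨hx1, fun β hβ => (hx2 β hβ.1 (h.ne_zero β hβ)).le⟩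

theorem exists_pos_of_eventually {p : (Fin n → ℝ) → Prop} {x : Fin n → ℝ} (h : ∀ᶠ y in 𝓝 x, p y)
    (z : Fin n → ℝ) : ∃ ε > 0, p (x + (ε : ℝ) • z) := by
  have hc : Continuous fun ε : ℝ => x + ε • z := by fun_prop
  have h0 : Tendsto (fun ε : ℝ => x + ε • z) (𝓝 0) (𝓝 x) := by
    simpa using hc.tendsto 0
  have := (h0.mono_left (nhdsWithin_le_nhds (s := Ioi (0 : ℝ)))).eventually h
  obtain ⟨ε, h1, h2⟩ := (this.and (self_mem_nhdsWithin (s := Ioi (0 : ℝ)))).exists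
  exact ⟨ε, h2, h1⟩

/-- The base point is interior to the chamber, so it can be moved a little in the direction of `α`
without violating `(·, α) ≤ 0`. -/
theorem RootData.IsBasePoint.form_neg (h : D.IsBasePoint x₀) {α : Fin n → ℤ} (hα : α ∈ D.P) :
    form D.B x₀ (ofInt ℝ α) < 0 := by
  obtain ⟨ε, hε, hm⟩ := exists_pos_of_eventually h.eventually_mem_C (ofInt ℝ α)
  have := (RootData.mem_C.1 hm).2 α hα
  rw [form_add_left, form_smul_left] at this
  have := mul_pos hε ((D.root α hα).form_pos (K := ℝ))
  linarith

theorem RootData.IsBasePoint.form_nonpos (h : D.IsBasePoint x₀) {β : Fin n → ℤ}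
    (hβ : β ∈ rootsOf D.B D.W) (hneg : form D.B x₀ (ofInt ℝ β) < 0) {x : Fin n → ℝ}
    (hx : x ∈ D.C) : form D.B x (ofInt ℝ β) ≤ 0 := by
  rw [h.C_eq] at hx
  exact nonpos_of_mul_nonneg_right (hx.2 β hβ) hneg

/-- A point of the chamber in the relative interior of the wall of a simple root. -/
theorem RootData.IsBasePoint.exists_wall_point (h : D.IsBasePoint x₀) {α : Fin n → ℤ}
    (hα : α ∈ D.P) : ∃ y ∈ D.C, form D.B y (ofInt ℝ α) = 0 ∧
      ∀ z, form D.B z (ofInt ℝ α) = 0 → ∃ ε > 0, y + (ε : ℝ) • z ∈ D.C := by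
  -- By minimality of `P`, dropping `α` enlarges the region, so some `y'` in the cone violates the
  -- inequality of `α` alone. The segment from `x₀` to `y'` crosses the wall.
  have hne : D.C ≠ {x ∈ posCone D.B D.u | ∀ β ∈ D.P \ {α}, form D.B x (ofInt ℝ β) ≤ 0} := by
    intro he
    have := D.minimal (D.P \ {α}) sdiff_subset he
    rw [← D.P_eq] at this
    rw [← this] at hα
    exact hα.2 rfl
  have : ∃ y' ∈ posCone D.B D.u, (∀ β ∈ D.P \ {α}, form D.B y' (ofInt ℝ β) ≤ 0) ∧
      0 < form D.B y' (ofInt ℝ α) := by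
    by_contra! hcon
    refine hne (Subset.antisymm (fun x hx => ⟨(RootData.mem_C.1 hx).1,
      fun β hβ => (RootData.mem_C.1 hx).2 β hβ.1⟩) fun x hx => RootData.mem_C.2 ⟨hx.1, ?_⟩)
    intro β hβ
    by_cases hβα : β = α
    · subst hβα; exact hcon x hx.1 hx.2
    · exact hx.2 β ⟨hβ, hβα⟩
  obtain ⟨y', hy', hy1, hy2⟩ := this
  have hx2 := h.form_neg hα
  set p := form D.B y' (ofInt ℝ α) with hp
  set q := form D.B x₀ (ofInt ℝ α) with hq
  have hpq : 0 < p - q := by linarith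
  -- The weight for which `t x₀ + (1 - t) y'` is orthogonal to `α`.
  set t := p / (p - q) with ht
  have ht0 : 0 < t := div_pos hy2 hpq
  have ht1 : 0 < 1 - t := by rw [ht, sub_pos, div_lt_one hpq]; linarith
  have hzero : ∀ z, form D.B z (ofInt ℝ α) = 0 → x₀ + z ∈ D.C →
      t • (x₀ + z) + (1 - t) • y' ∈ D.C := by
    intro z hz hzC
    rw [RootData.mem_C] at hzC ⊢
    refine ⟨D.hyperbolic.add_mem_posCone D.u_neg (smul_mem_posCone hzC.1 ht0)
      (smul_mem_posCone hy' ht1), fun β hβ => ?_⟩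
    rw [form_add_left, form_smul_left, form_smul_left]
    by_cases hβα : β = α
    · subst hβα
      rw [form_add_left, hz, ← hp, ← hq, ht]
      apply le_of_eq
      field_simp
      ring
    · have h1 := hzC.2 β hβ
      have h2 := hy1 β ⟨hβ, hβα⟩
      nlinarith
  refine ⟨t • x₀ + (1 - t) • y', by simpa using hzero 0 (by simp) (by simpa using h.mem_C), ?_, ?_⟩
  · rw [form_add_left, form_smul_left, form_smul_left, ← hp, ← hq, ht]
    field_simp
    ring
  · intro z hz
    obtain ⟨ε, hε, hm⟩ := exists_pos_of_eventually h.eventually_mem_C z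
    refine ⟨t * ε, by positivity, ?_⟩
    have := hzero (ε • z) (by rw [form_smul_left, hz, mul_zero]) hm
    convert this using 1
    rw [smul_add, smul_smul]
    abel

/-- A functional that is nonpositive on the chamber and zero at a relative interior point of a wall
is nonpositive on the whole hyperplane `α⊥`, hence zero there, hence a multiple of `(·, α)`. -/
theorem RootData.eq_smul_of_wall {α : Fin n → ℤ} (hα : α ∈ D.P)
    {y v : Fin n → ℝ} (hwall : ∀ z, form D.B z (ofInt ℝ α) = 0 → ∃ ε > 0, y + (ε : ℝ) • z ∈ D.C)
    (hv : ∀ x ∈ D.C, form D.B x v ≤ 0) (hyv : form D.B y v = 0) :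
    v = (form D.B v (ofInt ℝ α) / form D.B (ofInt ℝ α) (ofInt ℝ α)) • ofInt ℝ α := by
  have hs := D.hyperbolic.1
  have hpos := (D.root α hα).form_pos (K := ℝ)
  set a := ofInt ℝ α with ha
  have h1 : ∀ z, form D.B z a = 0 → form D.B z v ≤ 0 := by
    intro z hz
    obtain ⟨ε, hε, hm⟩ := hwall z hz
    have := hv _ hm
    rw [form_add_left, form_smul_left, hyv, zero_add] at this
    exact nonpos_of_mul_nonpos_right this hε
  have h2 : ∀ z, form D.B z a = 0 → form D.B z v = 0 := by
    intro z hz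
    have := h1 (-z) (by rw [form_neg_left, hz, neg_zero])
    rw [form_neg_left] at this
    linarith [h1 z hz]
  rw [← sub_eq_zero]
  refine D.hyperbolic.eq_zero_of_forall fun y => ?_
  have h3 := h2 (y - (form D.B y a / form D.B a a) • a) (by
    rw [form_sub_left, form_smul_left]; field_simp; ring)
  rw [form_sub_left, form_smul_left] at h3 ⊢
  rw [form_comm hs v y, form_comm hs a y]
  rw [form_comm hs a v] at h3
  rw [← h3]
  ring

/-- If roots of the lattice cut out the chamber, then each wall belongs to one of them. -/
theorem RootData.IsBasePoint.exists_eq_smul (h : D.IsBasePoint x₀) {Q : Set (Fin n → ℤ)}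
    (hQ : ∀ β ∈ Q, IsRoot D.B β)
    (hC : D.C = {x ∈ posCone D.B D.u | ∀ β ∈ Q, form D.B x (ofInt ℝ β) ≤ 0})
    {α : Fin n → ℤ} (hα : α ∈ D.P) : ∃ β ∈ Q, ∃ c : ℝ, 0 < c ∧ ofInt ℝ β = c • ofInt ℝ α := by
  obtain ⟨y, hyC, hy0, hwall⟩ := h.exists_wall_point hα
  have hyV := (RootData.mem_C.1 hyC).1
  have hpos := (D.root α hα).form_pos (K := ℝ)
  have hev : ∀ᶠ x in 𝓝 y, x ∈ posCone D.B D.u ∧ ∀ β : Fin n → ℤ, IsRoot D.B β →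
      form D.B y (ofInt ℝ β) ≠ 0 → 0 < form D.B y (ofInt ℝ β) * form D.B x (ofInt ℝ β) :=
    Filter.Eventually.and (isOpen_posCone.mem_nhds hyV) (D.hyperbolic.eventually_root_sign hyV.1)
  -- Step across the wall by so little that no root with nonzero product with `y` changes sign. A
  -- root of `Q` excluding the new point must then vanish at `y`.
  obtain ⟨ε, hε, hm1, hm2⟩ := exists_pos_of_eventually hev (ofInt ℝ α)
  have hnot : y + ε • ofInt ℝ α ∉ D.C := by
    intro hm
    have := (RootData.mem_C.1 hm).2 α hα
    rw [form_add_left, form_smul_left, hy0] at this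
    nlinarith
  have : ∃ β ∈ Q, 0 < form D.B (y + ε • ofInt ℝ α) (ofInt ℝ β) := by
    by_contra! hcon
    exact hnot (by rw [hC]; exact ⟨hm1, hcon⟩)
  obtain ⟨β, hβ, hβpos⟩ := this
  have hβC : ∀ x ∈ D.C, form D.B x (ofInt ℝ β) ≤ 0 := by
    intro x hx
    rw [hC] at hx
    exact hx.2 β hβ
  have hyβ : form D.B y (ofInt ℝ β) = 0 := by
    by_contra hne
    have h1 := hm2 β (hQ β hβ) hne
    have h2 := hβC y hyC
    nlinarith
  have he := RootData.eq_smul_of_wall hα hwall hβC hyβ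
  refine ⟨β, hβ, _, ?_, he⟩
  rw [form_add_left, form_smul_left, hyβ, zero_add, form_comm D.hyperbolic.1] at hβpos
  exact div_pos (pos_of_mul_pos_right hβpos hε.le) hpos

/-- `P` is only assumed to consist of roots of `S`. The roots of `W` negative on `x₀` cut out the
same chamber, so each wall belongs to one of them, and proportional roots have the same reflection.
-/
theorem RootData.mem_rootsOf {α : Fin n → ℤ} (hα : α ∈ D.P) : α ∈ rootsOf D.B D.W := by
  obtain ⟨x₀, h⟩ := D.exists_basePoint
  obtain ⟨β, ⟨hβ, -⟩, c, hc, he⟩ := h.exists_eq_smul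
    (Q := {β | β ∈ rootsOf D.B D.W ∧ form D.B x₀ (ofInt ℝ β) < 0}) (fun β hβ => hβ.1.1) (by
      rw [h.C_eq]
      refine Subset.antisymm (fun x hx => ⟨hx.1, fun β hβ => ?_⟩) fun x hx => ⟨hx.1, fun β hβ => ?_⟩
      · exact nonpos_of_mul_nonneg_right (hx.2 β hβ.1) hβ.2
      · rcases lt_or_gt_of_ne (h.ne_zero β hβ) with hlt | hgt
        · exact mul_nonneg_of_nonpos_of_nonpos hlt.le (hx.2 β ⟨hβ, hlt⟩)
        · have := hx.2 (-β) ⟨neg_mem_rootsOf hβ, by rw [ofInt_neg, form_neg_right]; linarith⟩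
          rw [ofInt_neg, form_neg_right] at this
          exact mul_nonneg hgt.le (by linarith)) hα
  obtain ⟨-, s, hs, hr⟩ := hβ
  refine ⟨D.root α hα, s, hs, hr.of_smul (inv_ne_zero hc.ne') ?_⟩
  rw [he, smul_smul, inv_mul_cancel₀ hc.ne', one_smul]

theorem RootData.exists_reflection {α : Fin n → ℤ} (hα : α ∈ D.P) :
    ∃ s ∈ D.W, IsReflection D.B α s := (RootData.mem_rootsOf hα).2

-- Without simple roots the chamber would be all of `V⁺`, but a reflection of `W` moves `x₀` across
-- its mirror.
variable (D) in
theorem RootData.P_nonempty : D.P.Nonempty := by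
  obtain ⟨x₀, h⟩ := D.exists_basePoint
  by_contra hemp
  rw [not_nonempty_iff_eq_empty] at hemp
  have hC : ∀ x ∈ posCone D.B D.u, x ∈ D.C := fun x hx =>
    RootData.mem_C.2 ⟨hx, by simp [hemp]⟩
  apply D.W_nontrivial
  obtain ⟨R, hR, hW⟩ := D.W_refl
  rw [hW, Subgroup.closure_eq_bot_iff]
  rintro s ⟨α, hα, hs⟩
  exfalso
  have hroot : α ∈ rootsOf D.B D.W :=
    ⟨hR α hα, s, by rw [hW]; exact Subgroup.subset_closure ⟨α, hα, hs⟩, hs⟩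
  have hm := hC _ (act_mem_posCone (hs.mem_orthPlus D.hyperbolic D.u_neg (hR α hα)) h.mem)
  rw [h.C_eq] at hm
  have := hm.2 α hroot
  have ho := hs.mem_orthGroup D.hyperbolic.1 (hR α hα)
  rw [form_act_left ho, hs.inv_eq (hR α hα), hs.act_self (hR α hα), form_neg_right] at this
  have := mul_self_pos.2 (h.ne_zero α hroot)
  linarith

/-- The symmetries of the chamber permute the walls. -/
theorem RootData.exists_smul_of_symM {g : GL (Fin n) ℤ} (hg : g ∈ D.symM) {α : Fin n → ℤ}
    (hα : α ∈ D.P) : ∃ β ∈ D.P, ∃ c : ℝ, 0 < c ∧ ofInt ℝ (act g β) = c • ofInt ℝ α := by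
  obtain ⟨x₀, h⟩ := D.exists_basePoint
  have ho : g ∈ orthGroup D.B := hg.1.1
  -- The image of `P` under `g` also cuts out the chamber.
  obtain ⟨_, ⟨β, hβ, rfl⟩, c, hc, he⟩ := h.exists_eq_smul (Q := act g '' D.P)
    (by rintro _ ⟨β, hβ, rfl⟩; exact (D.root β hβ).act ho) (by
      have hmem : ∀ x, x ∈ D.C ↔ act g⁻¹ x ∈ D.C := fun x =>
        ⟨fun hx => act_mem_of_mem_setStab ((setStab D.C).inv_mem hg.2) hx, fun hx => by
          simpa using act_mem_of_mem_setStab hg.2 hx⟩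
      have hV : ∀ x, x ∈ posCone D.B D.u ↔ act g⁻¹ x ∈ posCone D.B D.u := fun x =>
        ⟨fun hx => act_mem_of_mem_setStab ((setStab _).inv_mem hg.1.2) hx, fun hx => by
          simpa using act_mem_of_mem_setStab hg.1.2 hx⟩
      ext x
      rw [hmem, RootData.mem_C, ← hV]
      simp only [forall_mem_image, ← act_ofInt, form_act_right ho]
      rfl) hα
  exact ⟨β, hβ, c, hc, he⟩

end Chamber

/-! ### The Weyl group as a Coxeter group -/

section Coxeter

variable {n : ℕ} {D : RootData n} {x₀ : Fin n → ℝ}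

theorem RootData.exists_act_eq_smul {g : GL (Fin n) ℤ} (hg : g ∈ D.symM) {α : Fin n → ℤ}
    (hα : α ∈ D.P) : ∃ β ∈ D.P, ∃ c : ℝ, 0 < c ∧ ofInt ℝ (act g α) = c • ofInt ℝ β := by
  obtain ⟨β, hβ, c, hc, he⟩ := RootData.exists_smul_of_symM (D.symM.inv_mem hg) hα
  refine ⟨β, hβ, c⁻¹, inv_pos.2 hc, ?_⟩
  rw [← act_ofInt] at he ⊢
  have := congrArg (act g) he
  rw [act_act_inv, act_smul] at this
  rw [this, smul_smul, inv_mul_cancel₀ hc.ne', one_smul]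

/-- A simple reflection permutes the positive roots that are not multiples of its root. -/
theorem RootData.IsBasePoint.reflection_neg (h : D.IsBasePoint x₀) {α β : Fin n → ℤ}
    (hα : α ∈ D.P) {s : GL (Fin n) ℤ} (hsW : s ∈ D.W) (hs : IsReflection D.B α s)
    (hβ : β ∈ rootsOf D.B D.W) (hneg : form D.B x₀ (ofInt ℝ β) < 0) :
    (∃ c : ℝ, 0 < c ∧ ofInt ℝ β = c • ofInt ℝ α) ∨ form D.B x₀ (ofInt ℝ (act s β)) < 0 := by
  obtain ⟨y, hyC, hy0, hwall⟩ := h.exists_wall_point hα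
  have hβC : ∀ x ∈ D.C, form D.B x (ofInt ℝ β) ≤ 0 := fun x hx => h.form_nonpos hβ hneg hx
  -- A wall point `y` of `α` is fixed by `s`. If `(y, β) < 0`, the sign of `β` at `y` survives `s`;
  -- if `(y, β) = 0`, then `β` is a multiple of `α`.
  rcases (hβC y hyC).lt_or_eq with hlt | heq
  · right
    have hsβ := act_mem_rootsOf D.W_le_orth hsW hβ
    have hy : form D.B y (ofInt ℝ (act s β)) = form D.B y (ofInt ℝ β) := by
      rw [← act_ofInt, form_act_right (D.W_le_orth hsW), hs.inv_eq (D.root α hα), hs.act_eq, hy0]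
      simp
    by_contra! hle
    have hpos := lt_of_le_of_ne hle (h.ne_zero _ hsβ).symm
    have := h.form_nonpos (neg_mem_rootsOf hsβ) (by rw [ofInt_neg, form_neg_right]; linarith) hyC
    rw [ofInt_neg, form_neg_right, hy] at this
    linarith
  · left
    have he := RootData.eq_smul_of_wall hα hwall hβC heq
    refine ⟨_, ?_, he⟩
    rw [he, form_smul_right] at hneg
    exact pos_of_mul_neg_left hneg (h.form_neg hα).le

/-- The reflections in the simple roots. -/
def RootData.simpleReflections (D : RootData n) : Set (GL (Fin n) ℤ) :=
  {s | ∃ α ∈ D.P, IsReflection D.B α s}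

theorem RootData.simpleReflections_subset : D.simpleReflections ⊆ D.W := by
  rintro s ⟨α, hα, hs⟩
  obtain ⟨t, ht, ht'⟩ := RootData.exists_reflection hα
  rwa [hs.unique ht']

theorem RootData.mul_self_of_simple {s : GL (Fin n) ℤ} (hs : s ∈ D.simpleReflections) :
    s * s = 1 := by
  obtain ⟨α, hα, hs⟩ := hs
  exact hs.mul_self (D.root α hα)

/-- Positive roots have nonpositive product with the vectors whose products with the simple roots
are nonpositive, and their reflections are products of simple reflections. -/
theorem RootData.IsBasePoint.positive_root (h : D.IsBasePoint x₀) {β : Fin n → ℤ}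
    (hβ : β ∈ rootsOf D.B D.W) (hneg : form D.B x₀ (ofInt ℝ β) < 0) :
    (∀ v : Fin n → ℝ, (∀ α ∈ D.P, form D.B v (ofInt ℝ α) ≤ 0) → form D.B v (ofInt ℝ β) ≤ 0) ∧
    ∀ s, IsReflection D.B β s → s ∈ Subgroup.closure D.simpleReflections := by
  obtain ⟨c, hc'⟩ : ∃ c : ℝ, form D.B (ofInt ℝ β) (ofInt ℝ β) ≤ c := ⟨_, le_rfl⟩
  have hfin := D.hyperbolic.finite_form_le h.mem.1 c
  obtain ⟨N, hN⟩ : ∃ N, {γ : Fin n → ℤ | form D.B (ofInt ℝ γ) (ofInt ℝ γ) ≤ c ∧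
      |form D.B (ofInt ℝ γ) x₀| ≤ -form D.B x₀ (ofInt ℝ β)}.ncard = N := ⟨_, rfl⟩
  -- The induction is on the number of lattice vectors of bounded square that are no deeper than
  -- `β`, measured by the product with `x₀`; a suitable simple reflection makes this number drop.
  induction N using Nat.strong_induction_on generalizing β with
  | _ N ih =>
  by_cases hsim : ∃ α ∈ D.P, ∃ c : ℝ, 0 < c ∧ ofInt ℝ β = c • ofInt ℝ α
  · obtain ⟨α, hα, d, hd, he⟩ := hsim
    refine ⟨fun v hv => ?_, fun s hs => Subgroup.subset_closure ⟨α, hα, ?_⟩⟩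
    · rw [he, form_smul_right]
      exact mul_nonpos_of_nonneg_of_nonpos hd.le (hv α hα)
    · refine hs.of_smul (inv_ne_zero hd.ne') ?_
      rw [he, smul_smul, inv_mul_cancel₀ hd.ne', one_smul]
  obtain ⟨t, htW, ht⟩ := hβ.2
  have htV := act_mem_posCone (D.W_le htW) h.mem
  have hββ := hβ.1.form_pos (K := ℝ)
  -- If `β` had nonpositive product with all simple roots, the reflection of `x₀` in `β` would stay
  -- in the chamber, although it lies on the other side of the mirror of `β`.
  have hex : ∃ α ∈ D.P, 0 < form D.B (ofInt ℝ β) (ofInt ℝ α) := by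
    by_contra! hcon
    have hm : act t x₀ ∈ D.C := by
      refine RootData.mem_C.2 ⟨htV, fun α hα => ?_⟩
      rw [ht.act_eq, form_sub_left, form_smul_left]
      have h1 := h.form_neg hα
      have h2 : 2 * form D.B x₀ (ofInt ℝ β) / form D.B (ofInt ℝ β) (ofInt ℝ β) ≤ 0 :=
        div_nonpos_of_nonpos_of_nonneg (by linarith) hββ.le
      have := mul_nonneg_of_nonpos_of_nonpos h2 (hcon α hα)
      linarith
    have h3 := h.form_nonpos hβ hneg hm
    rw [form_act_left (D.W_le_orth htW), ht.inv_eq hβ.1, ht.act_self hβ.1, form_neg_right] at h3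
    linarith
  obtain ⟨α, hα, hαβ⟩ := hex
  obtain ⟨s, hsW, hs⟩ := RootData.exists_reflection hα
  have hαα := (D.root α hα).form_pos (K := ℝ)
  have hβ' := act_mem_rootsOf D.W_le_orth hsW hβ
  have hneg' : form D.B x₀ (ofInt ℝ (act s β)) < 0 := by
    rcases h.reflection_neg hα hsW hs hβ hneg with hl | hr
    · exact absurd ⟨α, hα, hl⟩ hsim
    · exact hr
  have hk : 0 < 2 * form D.B (ofInt ℝ β) (ofInt ℝ α) / form D.B (ofInt ℝ α) (ofInt ℝ α) := by
    positivity
  have heq : ofInt ℝ (act s β) = ofInt ℝ β -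
      (2 * form D.B (ofInt ℝ β) (ofInt ℝ α) / form D.B (ofInt ℝ α) (ofInt ℝ α)) • ofInt ℝ α := by
    rw [← act_ofInt, hs.act_eq]
  set k := 2 * form D.B (ofInt ℝ β) (ofInt ℝ α) / form D.B (ofInt ℝ α) (ofInt ℝ α)
  have hnorm : form D.B (ofInt ℝ (act s β)) (ofInt ℝ (act s β)) ≤ c := by
    rw [← act_ofInt, form_act (D.W_le_orth hsW)]; exact hc'
  have hlt : form D.B x₀ (ofInt ℝ β) < form D.B x₀ (ofInt ℝ (act s β)) := by
    rw [heq, form_sub_right, form_smul_right]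
    have := mul_neg_of_pos_of_neg hk (h.form_neg hα)
    linarith
  have hcard : {γ : Fin n → ℤ | form D.B (ofInt ℝ γ) (ofInt ℝ γ) ≤ c ∧
      |form D.B (ofInt ℝ γ) x₀| ≤ -form D.B x₀ (ofInt ℝ (act s β))}.ncard < N := by
    rw [← hN]
    refine ncard_lt_ncard ⟨fun γ hγ => ⟨hγ.1, hγ.2.trans (by linarith)⟩, fun hsub => ?_⟩ (hfin _)
    have hm : β ∈ {γ : Fin n → ℤ | form D.B (ofInt ℝ γ) (ofInt ℝ γ) ≤ c ∧
        |form D.B (ofInt ℝ γ) x₀| ≤ -form D.B x₀ (ofInt ℝ β)} := by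
      refine ⟨hc', ?_⟩
      rw [form_comm D.hyperbolic.1, abs_of_neg hneg]
    have h4 := (hsub hm).2
    rw [form_comm D.hyperbolic.1, abs_of_neg hneg] at h4
    linarith
  obtain ⟨ih1, ih2⟩ := ih _ hcard hβ' hneg' hnorm rfl
  refine ⟨fun v hv => ?_, fun r hr => ?_⟩
  · have h5 := ih1 v hv
    rw [heq, form_sub_right, form_smul_right] at h5
    have := mul_nonpos_of_nonneg_of_nonpos hk.le (hv α hα)
    linarith
  · have h6 := ih2 _ (hr.conj (D.W_le_orth hsW))
    have hsS : s ∈ Subgroup.closure D.simpleReflections := Subgroup.subset_closure ⟨α, hα, hs⟩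
    have := Subgroup.mul_mem _ (Subgroup.mul_mem _ (Subgroup.inv_mem _ hsS) h6) hsS
    simpa [mul_assoc] using this

variable (D) in
theorem RootData.W_eq_closure : D.W = Subgroup.closure D.simpleReflections := by
  obtain ⟨x₀, h⟩ := D.exists_basePoint
  refine le_antisymm ?_ ((Subgroup.closure_le _).2 RootData.simpleReflections_subset)
  obtain ⟨R, hR, hW⟩ := D.W_refl
  conv_lhs => rw [hW]
  rw [Subgroup.closure_le]
  rintro s ⟨α, hα, hs⟩
  have hroot : α ∈ rootsOf D.B D.W :=
    ⟨hR α hα, s, by rw [hW]; exact Subgroup.subset_closure ⟨α, hα, hs⟩, hs⟩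
  rcases lt_or_gt_of_ne (h.ne_zero α hroot) with hlt | hgt
  · exact (h.positive_root hroot hlt).2 s hs
  · exact (h.positive_root (neg_mem_rootsOf hroot)
      (by rw [ofInt_neg, form_neg_right]; linarith)).2 s
      (hs.of_smul (c := -1) (by norm_num) (by simp))

theorem RootData.exists_word {w : GL (Fin n) ℤ} (hw : w ∈ D.W) :
    ∃ L : List (GL (Fin n) ℤ), (∀ s ∈ L, s ∈ D.simpleReflections) ∧ L.prod = w := by
  rw [D.W_eq_closure] at hw
  rw [← Subgroup.mem_toSubmonoid, Subgroup.closure_toSubmonoid] at hw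
  obtain ⟨L, hL, hp⟩ := Submonoid.exists_list_of_mem_closure hw
  refine ⟨L, fun s hs => ?_, hp⟩
  rcases hL s hs with h | h
  · exact h
  · have := inv_eq_of_mul_eq_one_right (RootData.mul_self_of_simple h)
    rw [inv_inv] at this
    rw [this]
    exact h

theorem RootData.prod_mem_W {L : List (GL (Fin n) ℤ)} (hL : ∀ s ∈ L, s ∈ D.simpleReflections) :
    L.prod ∈ D.W :=
  Subgroup.list_prod_mem _ fun s hs => RootData.simpleReflections_subset (hL s hs)

theorem RootData.prod_reverse {L : List (GL (Fin n) ℤ)}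
    (hL : ∀ s ∈ L, s ∈ D.simpleReflections) : L.reverse.prod = L.prod⁻¹ := by
  rw [List.prod_inv_reverse]
  congr 1
  rw [List.map_congr_left (g := id), List.map_id]
  intro s hs
  exact inv_eq_of_mul_eq_one_right (RootData.mul_self_of_simple (hL s hs))

/-- The exchange condition. -/
theorem RootData.IsBasePoint.exchange (h : D.IsBasePoint x₀) {α : Fin n → ℤ} (hα : α ∈ D.P)
    {s : GL (Fin n) ℤ} (hs : IsReflection D.B α s) {L : List (GL (Fin n) ℤ)}
    (hL : ∀ s ∈ L, s ∈ D.simpleReflections)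
    (hpos : 0 < form D.B x₀ (ofInt ℝ (act L.prod α))) :
    ∃ L' : List (GL (Fin n) ℤ), (∀ s ∈ L', s ∈ D.simpleReflections) ∧ L'.length < L.length ∧
      L'.prod = L.prod * s := by
  induction L with
  | nil =>
    rw [List.prod_nil, act_one_apply] at hpos
    exact absurd (h.form_neg hα) (not_lt.2 hpos.le)
  | cons t L ih =>
    have hL' : ∀ s ∈ L, s ∈ D.simpleReflections := fun r hr => hL r (List.mem_cons_of_mem _ hr)
    have htS := hL t List.mem_cons_self
    obtain ⟨γ, hγ, ht⟩ := htS
    have hLW := RootData.prod_mem_W hL'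
    have hβ := act_mem_rootsOf D.W_le_orth hLW (RootData.mem_rootsOf hα)
    rw [List.prod_cons, act_mul_apply] at hpos
    rcases lt_or_gt_of_ne (h.ne_zero _ hβ) with hlt | hgt
    · rcases h.reflection_neg hγ (RootData.simpleReflections_subset ⟨γ, hγ, ht⟩) ht hβ hlt with
        ⟨c, hc, he⟩ | hneg
      -- The sign changes exactly at the letter `t`, so `t` is the conjugate of `s` by the rest of
      -- the word, and it cancels.
      · refine ⟨L, hL', by simp, ?_⟩
        have h1 : IsReflection D.B γ (L.prod * s * L.prod⁻¹) :=
          (hs.conj (D.W_le_orth hLW)).of_smul (inv_ne_zero hc.ne') (by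
            rw [he, smul_smul, inv_mul_cancel₀ hc.ne', one_smul])
        have h2 : t = L.prod * s * L.prod⁻¹ := ht.unique h1
        have h3 : t * L.prod = L.prod * s := by rw [h2]; group
        rw [List.prod_cons, mul_assoc, ← h3, ← mul_assoc, ht.mul_self (D.root γ hγ), one_mul]
      · exact absurd hpos (not_lt.2 hneg.le)
    · obtain ⟨L₁, h1, h2, h3⟩ := ih hL' hgt
      refine ⟨t :: L₁, ?_, by simpa using h2, by rw [List.prod_cons, List.prod_cons, h3, mul_assoc]⟩
      intro r hr
      rcases List.mem_cons.1 hr with rfl | hr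
      · exact hL r List.mem_cons_self
      · exact h1 r hr

/-- A strictly dominant vector is only moved by `W` to a dominant vector by the identity. -/
theorem RootData.eq_one_of_dominant {w : GL (Fin n) ℤ} (hw : w ∈ D.W) {v : Fin n → ℝ}
    (hv : ∀ α ∈ D.P, form D.B v (ofInt ℝ α) < 0)
    (hwv : ∀ α ∈ D.P, form D.B (act w v) (ofInt ℝ α) ≤ 0) : w = 1 := by
  obtain ⟨x₀, h⟩ := D.exists_basePoint
  obtain ⟨L, hL, rfl⟩ := RootData.exists_word hw
  induction hN : L.length using Nat.strong_induction_on generalizing L with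
  | _ N ih =>
  rcases L.eq_nil_or_concat with rfl | ⟨L₀, s, rfl⟩
  · rfl
  have hL₀ : ∀ s ∈ L₀, s ∈ D.simpleReflections := fun r hr => hL r (by simp [hr])
  obtain ⟨α, hα, hs⟩ := hL s (by simp)
  have hp : (L₀.concat s).prod = L₀.prod * s := by simp
  have hLW := RootData.prod_mem_W hL₀
  have hβ := act_mem_rootsOf D.W_le_orth hLW (RootData.mem_rootsOf hα)
  rcases lt_or_gt_of_ne (h.ne_zero _ hβ) with hlt | hgt
  · exfalso
    -- If the last letter lengthens the word, `L₀ α` is a positive root, and dominance of `w v`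
    -- forces `(v, α) ≥ 0`.
    have h1 := (h.positive_root hβ hlt).1 _ hwv
    rw [hp, ← act_ofInt, act_mul_apply, form_act (D.W_le_orth hLW),
      form_act_left (D.W_le_orth (RootData.simpleReflections_subset ⟨α, hα, hs⟩)),
      hs.inv_eq (D.root α hα), hs.act_self (D.root α hα), form_neg_right] at h1
    linarith [hv α hα]
  · obtain ⟨L', h1, h2, h3⟩ := h.exchange hα hs hL₀ hgt
    rw [hp, ← h3] at hwv ⊢
    exact ih _ (by rw [← hN]; simp; omega) L' h1 (RootData.prod_mem_W h1) hwv rfl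

/-- On the chamber, a dominant vector is maximal in its orbit. -/
theorem RootData.form_act_le {w : GL (Fin n) ℤ} (hw : w ∈ D.W) {v x : Fin n → ℝ}
    (hv : ∀ α ∈ D.P, form D.B v (ofInt ℝ α) ≤ 0) (hx : x ∈ D.C) :
    form D.B x (act w v) ≤ form D.B x v := by
  obtain ⟨x₀, h⟩ := D.exists_basePoint
  obtain ⟨L, hL, rfl⟩ := RootData.exists_word hw
  induction hN : L.length using Nat.strong_induction_on generalizing L with
  | _ N ih =>
  rcases L with _ | ⟨t, L₁⟩
  · simp
  have hL₁ : ∀ s ∈ L₁, s ∈ D.simpleReflections := fun r hr => hL r (List.mem_cons_of_mem _ hr)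
  have htS := hL t List.mem_cons_self
  obtain ⟨γ, hγ, ht⟩ := htS
  have hLW := RootData.prod_mem_W hL₁
  have hβ := act_mem_rootsOf D.W_le_orth (D.W.inv_mem hLW) (RootData.mem_rootsOf hγ)
  have hγγ := (D.root γ hγ).form_pos (K := ℝ)
  rcases lt_or_gt_of_ne (h.ne_zero _ hβ) with hlt | hgt
  -- Here `(L₁ v, γ) ≤ 0`, so the letter `t` subtracts a nonpositive multiple of `γ`, which can only
  -- lower the product with a point of the chamber.
  · have h1 := (h.positive_root hβ hlt).1 v hv
    rw [← act_ofInt, form_act_right (D.W_le_orth (D.W.inv_mem hLW)), inv_inv] at h1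
    have h2 := ih _ (by rw [← hN]; simp) L₁ hL₁ hLW rfl
    refine le_trans ?_ h2
    rw [List.prod_cons, act_mul_apply, ht.act_eq (act L₁.prod v), form_sub_right, form_smul_right]
    have h3 : 2 * form D.B (act L₁.prod v) (ofInt ℝ γ) / form D.B (ofInt ℝ γ) (ofInt ℝ γ) ≤ 0 :=
      div_nonpos_of_nonpos_of_nonneg (by linarith) hγγ.le
    have := mul_nonneg_of_nonpos_of_nonpos h3 ((RootData.mem_C.1 hx).2 γ hγ)
    linarith
  -- Otherwise the word is not reduced. The exchange condition removes letters on the right, so it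
  -- is applied to the inverse word.
  · rw [← RootData.prod_reverse hL₁] at hgt
    obtain ⟨L', h1, h2, h3⟩ := h.exchange hγ ht (fun s hs => hL₁ s (by simpa using hs)) hgt
    have h4 : L'.reverse.prod = (t :: L₁).prod := by
      rw [RootData.prod_reverse h1, h3, RootData.prod_reverse hL₁, List.prod_cons, _root_.mul_inv_rev,
        inv_inv, ht.inv_eq (D.root γ hγ)]
    have h5 : ∀ s ∈ L'.reverse, s ∈ D.simpleReflections := fun s hs => h1 s (by simpa using hs)
    rw [← h4]
    refine ih _ ?_ L'.reverse h5 (RootData.prod_mem_W h5) rfl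
    rw [← hN]
    simp at h2 ⊢
    omega

variable (D) in
theorem RootData.W_inf_symM : D.W ⊓ D.symM = ⊥ := by
  obtain ⟨x₀, h⟩ := D.exists_basePoint
  rw [eq_bot_iff]
  rintro w ⟨hw, hg⟩
  exact RootData.eq_one_of_dominant hw (fun α hα => h.form_neg hα)
    (RootData.mem_C.1 (act_mem_of_mem_setStab hg.2 h.mem_C)).2

/-- A symmetry of the chamber permutes the walls, hence the simple reflections, which generate `W`.
-/
theorem RootData.conj_mem_W {g w : GL (Fin n) ℤ} (hg : g ∈ D.symM) (hw : w ∈ D.W) :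
    g * w * g⁻¹ ∈ D.W := by
  suffices D.W ≤ D.W.comap (MulAut.conj g).toMonoidHom from this hw
  conv_lhs => rw [D.W_eq_closure]
  rw [Subgroup.closure_le]
  rintro s ⟨α, hα, hs⟩
  obtain ⟨β, hβ, c, hc, he⟩ := RootData.exists_act_eq_smul hg hα
  exact RootData.simpleReflections_subset ⟨β, hβ, (hs.conj hg.1.1).of_smul (inv_ne_zero hc.ne')
    (by rw [he, smul_smul, inv_mul_cancel₀ hc.ne', one_smul])⟩

variable (D) in
theorem RootData.symM_le_normalizer :
    D.symM ≤ Subgroup.normalizer (D.W : Set (GL (Fin n) ℤ)) := by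
  intro g hg
  rw [Subgroup.mem_normalizer_iff]
  refine fun w => ⟨fun hw => RootData.conj_mem_W hg hw, fun hw => ?_⟩
  have := RootData.conj_mem_W (D.symM.inv_mem hg) hw
  simpa [mul_assoc] using this

end Coxeter

/-! ### Hyperbolic isometries from Pell's equation -/

section PellIsometries

open Pell

variable {ι : Type*} [Fintype ι] {B : Matrix ι ι ℤ} {u : ι → ℝ}

theorem IsHyperbolic.form_pos_int (hB : IsHyperbolic B) {a x : ι → ℤ} (ha : form B a a < 0)
    (hxa : form B x a = 0) (hx : x ≠ 0) : 0 < form B x x := by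
  have h1 : form B (ofInt ℝ a) (ofInt ℝ a) < 0 := by rw [form_ofInt]; exact_mod_cast ha
  have h2 := hB.form_pos h1 (x := ofInt ℝ x) (by rw [form_ofInt, hxa, Int.cast_zero])
    (mt ofInt_eq_zero.1 hx)
  rw [form_ofInt] at h2
  exact_mod_cast h2

theorem form_int (x y : ι → ℤ) : form B x y = x ⬝ᵥ (B *ᵥ y) := by
  have e : B.map (Int.cast : ℤ → ℤ) = B := by ext; simp
  rw [form, e]

/-- The infinitesimal rotation in the plane spanned by `a` and `b`. -/
def rotation (B : Matrix ι ι ℤ) (a b : ι → ℤ) : Matrix ι ι ℤ :=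
  vecMulVec a (B *ᵥ b) - vecMulVec b (B *ᵥ a)

theorem rotation_mulVec (a b x : ι → ℤ) :
    rotation B a b *ᵥ x = form B x b • a - form B x a • b := by
  rw [rotation, sub_mulVec, vecMulVec_mulVec, vecMulVec_mulVec, form_int, form_int,
    dotProduct_comm x, dotProduct_comm x]
  funext i
  simp [mul_comm]

theorem rotation_mulVec_mulVec {a b : ι → ℤ} (hB : B.IsSymm) (hba : form B b a = 0) (x : ι → ℤ) :
    rotation B a b *ᵥ (rotation B a b *ᵥ x) =
      -((form B b b * form B x a) • a) - (form B a a * form B x b) • b := by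
  have hab : form B a b = 0 := by rw [form_comm hB, hba]
  rw [rotation_mulVec, rotation_mulVec]
  simp only [form_sub_left, form_smul_left, hba, hab]
  funext i
  simp
  ring

variable [DecidableEq ι]

theorem IsHyperbolic.mem_orthPlus_of_act_mem (hB : IsHyperbolic B) (hu : form B u u < 0)
    {g : GL ι ℤ} (hg : g ∈ orthGroup B) {a : ι → ℝ} (ha : a ∈ posCone B u)
    (hga : act g a ∈ posCone B u) : g ∈ orthPlus B u := by
  refine ⟨hg, mem_setStab_of_forall (fun x hx => ?_) fun x hx => ?_⟩
  · refine hB.mem_posCone hu hga (by rw [form_act hg]; exact hx.1) ?_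
    rw [form_act hg]
    exact hB.form_neg_of_mem hu hx ha
  · refine hB.mem_posCone hu ha (by rw [form_act ((orthGroup B).inv_mem hg)]; exact hx.1) ?_
    rw [← form_act_right hg]
    exact hB.form_neg_of_mem hu hx hga

/-- The non-square makes Pell's equation solvable, and `(b, v) > 0` keeps control of the direction
of `b`. If `v` itself fails, a third direction orthogonal to `a` and `v` perturbs a large multiple
of it; here rank at least 3 enters. -/
theorem IsHyperbolic.exists_nonsquare {n : ℕ} (hn : 3 ≤ n) {B : Matrix (Fin n) (Fin n) ℤ}
    (hB : IsHyperbolic B) {a v : Fin n → ℤ} (ha : form B a a < 0) (hva : form B v a = 0)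
    (hv : v ≠ 0) : ∃ b, form B b a = 0 ∧ 0 < form B b v ∧ 0 < form B b b ∧
      ¬IsSquare (-(form B a a * form B b b)) := by
  have hvv := hB.form_pos_int ha hva hv
  by_cases hsq : IsSquare (-(form B a a * form B v v))
  swap
  · exact ⟨v, hva, hvv, hvv, hsq⟩
  obtain ⟨r, hr⟩ := hsq
  obtain ⟨b, hb0, hba, hbv⟩ : ∃ b : Fin n → ℤ, b ≠ 0 ∧ form B b a = 0 ∧ form B b v = 0 := by
    let f : (Fin n → ℤ) →ₗ[ℤ] (Fin 2 → ℤ) :=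
      { toFun := fun x => ![form B x a, form B x v]
        map_add' := fun x y => by simp [form_add_left]
        map_smul' := fun c x => by rw [form_smul_left, form_smul_left]; simp }
    by_contra! hcon
    have hinj : Function.Injective f := by
      rw [← LinearMap.ker_eq_bot, LinearMap.ker_eq_bot']
      intro x hx
      by_contra hx0
      have h0 := congrFun hx 0
      have h1 := congrFun hx 1
      exact hcon x hx0 h0 h1
    have := le_of_fin_injective ℤ f hinj
    omega
  have hbb := hB.form_pos_int ha hba hb0
  have hvb : form B v b = 0 := by rw [form_comm hB.1, hbv]
  -- With `-a² v² = r²`, the vector `N v + b` gives `(N r)² + N`, strictly between the squares of `N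
  -- |r|` and `N |r| + 1`.
  set N := -(form B a a) * form B b b with hN
  have hNpos : 0 < N := mul_pos (by linarith) hbb
  have hform : form B (N • v + b) (N • v + b) = N ^ 2 * form B v v + form B b b := by
    simp only [form_add_left, form_add_right, form_smul_left, form_smul_right, hbv, hvb]
    ring
  refine ⟨N • v + b, ?_, ?_, ?_, ?_⟩
  · rw [form_add_left, form_smul_left, hva, hba]; ring
  · rw [form_add_left, form_smul_left, hbv]; nlinarith
  · rw [hform]; positivity
  · rintro ⟨s, hs⟩
    rw [hform] at hs
    have h1 : s ^ 2 = (N * |r|) ^ 2 + N := by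
      rw [mul_pow, sq_abs]; linear_combination -hs + N ^ 2 * hr
    have hr1 : 1 ≤ |r| := by
      apply Int.one_le_abs
      rintro rfl
      nlinarith
    have h2 : (N * |r|) ^ 2 < s ^ 2 := by rw [h1]; linarith
    have h3 : s ^ 2 < (N * |r| + 1) ^ 2 := by rw [h1]; nlinarith
    have h4 : N * |r| < |s| := lt_of_pow_lt_pow_left₀ 2 (abs_nonneg _) (by rwa [sq_abs])
    have h5 : |s| < N * |r| + 1 := lt_of_pow_lt_pow_left₀ 2 (by positivity) (by rwa [sq_abs])
    omega

theorem act_int (g : GL ι ℤ) (x : ι → ℤ) : act g x = g.val *ᵥ x := by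
  have e : g.val.map (Int.cast : ℤ → ℤ) = g.val := by ext; simp
  rw [act, e]

variable {a b : ι → ℤ}

theorem rotation_cube (hB : B.IsSymm) (hba : form B b a = 0) :
    rotation B a b * (rotation B a b * rotation B a b) =
    (-(form B a a * form B b b)) • rotation B a b := by
  have hab : form B a b = 0 := by rw [form_comm hB, hba]
  refine Matrix.ext_of_mulVec_single fun i => ?_
  rw [← mulVec_mulVec, ← mulVec_mulVec, rotation_mulVec_mulVec hB hba, smul_mulVec,
    rotation_mulVec]
  simp only [form_sub_left, form_smul_left, hba, hab]
  funext j
  simp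
  ring

/-- The isometry `1 + 2 x y J + 2 y² J²` attached to a solution `(x, y)` of Pell's equation, where
`J` is the infinitesimal rotation. -/
def pellMatrix (B : Matrix ι ι ℤ) (a b : ι → ℤ) (x y : ℤ) : Matrix ι ι ℤ :=
  1 + (2 * x * y) • rotation B a b + (2 * y ^ 2) • (rotation B a b * rotation B a b)

/-- Where `J² = d` each factor is `(x + yJ)²`, and on the kernel of `J` it is the identity, so
composition is multiplication of the numbers `x + y√d`. -/
theorem pellMatrix_mul {J : Matrix ι ι ℤ} {d : ℤ} (hJ : J * (J * J) = d • J) {x y z w : ℤ}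
    (hxy : x ^ 2 - d * y ^ 2 = 1) (hzw : z ^ 2 - d * w ^ 2 = 1) :
    (1 + (2 * x * y) • J + (2 * y ^ 2) • (J * J)) * (1 + (2 * z * w) • J + (2 * w ^ 2) • (J * J)) =
    1 + (2 * (x * z + d * (y * w)) * (x * w + y * z)) • J +
      (2 * (x * w + y * z) ^ 2) • (J * J) := by
  have hJ' : J * J * J = d • J := by rw [mul_assoc, hJ]
  have hJ'' : J * J * (J * J) = d • (J * J) := by rw [mul_assoc, hJ, mul_smul_comm]
  simp only [add_mul, mul_add, one_mul, mul_one, smul_mul_assoc, mul_smul_comm, hJ, hJ', hJ'',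
    smul_smul, smul_add]
  match_scalars
  · ring
  · linear_combination (-2 * x * y) * hzw - (2 * z * w) * hxy
  · linear_combination (-2 * y ^ 2) * hzw - (2 * w ^ 2) * hxy

/-- The solutions of Pell's equation act on the lattice. -/
def pellHom (B : Matrix ι ι ℤ) (a b : ι → ℤ) (hB : B.IsSymm) (hba : form B b a = 0) :
    Solution₁ (-(form B a a * form B b b)) →* GL ι ℤ :=
  MonoidHom.toHomUnits
    { toFun := fun s => pellMatrix B a b s.x s.y
      map_one' := by simp [pellMatrix]
      map_mul' := fun s t => by
        rw [pellMatrix, pellMatrix, pellMatrix, Solution₁.x_mul, Solution₁.y_mul,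
          pellMatrix_mul (rotation_cube hB hba) s.prop t.prop] }

theorem act_pellHom (hB : B.IsSymm) (hba : form B b a = 0)
    (s : Solution₁ (-(form B a a * form B b b))) (x : ι → ℤ) :
    act (pellHom B a b hB hba s) x =
      x + (2 * s.x * s.y * form B x b - 2 * s.y ^ 2 * form B b b * form B x a) • a -
        (2 * s.x * s.y * form B x a + 2 * s.y ^ 2 * form B a a * form B x b) • b := by
  rw [act_int]
  change pellMatrix B a b s.x s.y *ᵥ x = _
  rw [pellMatrix, add_mulVec, add_mulVec, one_mulVec, smul_mulVec, smul_mulVec, ← mulVec_mulVec,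
    rotation_mulVec_mulVec hB hba, rotation_mulVec]
  funext i
  simp
  ring

theorem pellHom_mem_orthPlus (hB : IsHyperbolic B) (hu : form B u u < 0) (hba : form B b a = 0)
    (ha : ofInt ℝ a ∈ posCone B u) (s : Solution₁ (-(form B a a * form B b b))) :
    pellHom B a b hB.1 hba s ∈ orthPlus B u := by
  have hab : form B a b = 0 := by rw [form_comm hB.1, hba]
  have hsymm := form_comm hB.1 (R := ℤ)
  have ho : pellHom B a b hB.1 hba s ∈ orthGroup B := by
    refine mem_orthGroup_of_form fun x y => ?_
    have hp := s.prop
    simp only [act_pellHom, form_add_left, form_add_right, form_sub_left, form_sub_right,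
      form_smul_left, form_smul_right, hba, hab, hsymm a y, hsymm b y]
    linear_combination (4 * s.y ^ 2 * (form B b b * form B x a * form B y a +
      form B a a * form B x b * form B y b)) * hp
  have haa : form B a a < 0 := by
    have := ha.1
    rw [form_ofInt] at this
    exact_mod_cast this
  -- It suffices to test the half cone on `a`, where `(g a, a) = a² (2x² - 1)`. The Pell
  -- discriminant is nonnegative, so `x ≠ 0`.
  refine hB.mem_orthPlus_of_act_mem hu ho ha (hB.mem_posCone hu ha ?_ ?_)
  · rw [form_act ho]; exact ha.1
  · rw [act_ofInt, form_ofInt, act_pellHom]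
    simp only [form_add_left, form_sub_left, form_smul_left, hba, hab]
    have : form B a a + (2 * s.x * s.y * 0 - 2 * s.y ^ 2 * form B b b * form B a a) * form B a a -
        (2 * s.x * s.y * form B a a + 2 * s.y ^ 2 * form B a a * 0) * 0 =
        form B a a * (2 * s.x ^ 2 - 1) := by linear_combination (-2 * form B a a) * s.prop
    rw [this]
    have hx : 0 < 2 * s.x ^ 2 - 1 := by
      have h1 := s.prop_x
      by_contra! hle
      have h2 : s.x = 0 := by nlinarith [sq_nonneg s.x]
      rw [h2] at h1
      have h3 : form B a a * form B b b * s.y ^ 2 = 1 := by linear_combination h1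
      have hb : 0 ≤ form B b b := by
        rcases eq_or_ne b 0 with rfl | hb
        · simp
        · exact (hB.form_pos_int haa hba hb).le
      nlinarith [mul_nonneg hb (sq_nonneg s.y)]
    exact_mod_cast mul_neg_of_neg_of_pos haa hx

/-- A subgroup of finite index contains the isometry attached to a solution of Pell's equation. -/
theorem exists_pellHom_mem (hB : IsHyperbolic B) (hu : form B u u < 0) (hba : form B b a = 0)
    (ha : ofInt ℝ a ∈ posCone B u) (hb : 0 < form B b b)
    (hsq : ¬IsSquare (-(form B a a * form B b b))) {H : Subgroup (GL ι ℤ)}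
    (hH : H.relIndex (orthPlus B u) ≠ 0) :
    ∃ s : Solution₁ (-(form B a a * form B b b)), 0 < s.x ∧ 0 < s.y ∧
      pellHom B a b hB.1 hba s ∈ H := by
  have haa : form B a a < 0 := by
    have := ha.1
    rw [form_ofInt] at this
    exact_mod_cast this
  obtain ⟨s, h1, h2⟩ := Solution₁.exists_pos_of_not_isSquare (by nlinarith) hsq
  obtain ⟨k, hk, -, hm⟩ := Subgroup.exists_pow_mem_of_relIndex_ne_zero hH
    (pellHom_mem_orthPlus hB hu hba ha s)
  have hx : 0 < s.x := by linarith
  obtain ⟨k, rfl⟩ := Nat.exists_eq_succ_of_ne_zero hk.ne'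
  refine ⟨s ^ (k + 1), Solution₁.x_pow_pos hx _, Solution₁.y_pow_succ_pos hx h2 _, ?_⟩
  rw [map_pow]
  exact hm.1

end PellIsometries

/-! ### Uniqueness of Fourier coefficients -/

section FourierUniqueness

open Filter Topology

variable {n : ℕ} {B : Matrix (Fin n) (Fin n) ℤ} {u : Fin n → ℝ}

/-- Take `n + 1` real numbers linearly independent over `ℚ` and divide by the first, so that `1` and
the `tᵢ` are independent. -/
theorem exists_generic_real (n : ℕ) : ∃ t : Fin n → ℝ, ∀ (l : Fin n → ℚ) (k : ℤ),
    ∑ i, (l i : ℝ) * t i = k → l = 0 := by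
  obtain ⟨s, hs, hli⟩ := (le_rank_iff_exists_linearIndependent_finset (K := ℚ) (V := ℝ)
    (n := n + 1)).1 (by
      rw [Real.rank_rat_real]; exact (Cardinal.natCast_lt_aleph0.trans Cardinal.aleph0_lt_continuum).le)
  let e := (Finset.equivFinOfCardEq hs).symm
  have hv : LinearIndependent ℚ (fun i : Fin (n + 1) => (e i : ℝ)) := hli.comp e e.injective
  have h0 : (e 0 : ℝ) ≠ 0 := hv.ne_zero 0
  refine ⟨fun i => (e i.succ : ℝ) / e 0, fun l k h => ?_⟩
  rw [Fintype.linearIndependent_iff] at hv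
  have h1 : ∑ i, (Fin.cons (-(k : ℚ)) l : Fin (n + 1) → ℚ) i • (e i : ℝ) = 0 := by
    rw [Fin.sum_univ_succ]
    simp only [Fin.cons_zero, Fin.cons_succ, Rat.smul_def]
    have h2 : ∑ i, (l i : ℝ) * (e i.succ : ℝ) = k * e 0 := by
      rw [← h, Finset.sum_mul]
      refine Finset.sum_congr rfl fun i _ => ?_
      field_simp
    rw [h2]
    push_cast
    ring
  funext i
  simpa using hv _ h1 i.succ

theorem IsHyperbolic.exists_generic (hB : IsHyperbolic B) : ∃ x : Fin n → ℝ,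
    ∀ (l : Fin n → ℚ) (k : ℤ), form B (fun i => (l i : ℝ)) x = k → l = 0 := by
  obtain ⟨t, ht⟩ := exists_generic_real n
  have hdet : IsUnit (B.map (Int.cast : ℤ → ℝ)).det := by
    have e : (B.map (Int.cast : ℤ → ℝ)).det = ((B.det : ℤ) : ℝ) :=
      ((Int.castRingHom ℝ).map_det B).symm
    rw [e, isUnit_iff_ne_zero]
    exact_mod_cast hB.det_ne_zero
  refine ⟨(B.map (Int.cast : ℤ → ℝ))⁻¹ *ᵥ t, fun l k h => ht l k ?_⟩
  rw [form, mulVec_mulVec, mul_nonsing_inv _ hdet, one_mulVec] at h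
  exact h

theorem norm_mean_pow_le {q : ℂ} (hq : ‖q‖ = 1) (T : ℕ) :
    ‖(T : ℂ)⁻¹ * ∑ j ∈ Finset.range T, q ^ j‖ ≤ 1 := by
  rw [norm_mul, norm_inv, Complex.norm_natCast]
  have h1 : ‖∑ j ∈ Finset.range T, q ^ j‖ ≤ T := by
    refine (norm_sum_le _ _).trans ?_
    simp [norm_pow, hq]
  calc _ ≤ (T : ℝ)⁻¹ * T := by gcongr
    _ ≤ 1 := inv_mul_le_one

/-- The geometric sums stay bounded by `2 / ‖q - 1‖`. -/
theorem tendsto_mean_pow {q : ℂ} (hq : ‖q‖ = 1) (hq1 : q ≠ 1) :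
    Tendsto (fun T : ℕ => (T : ℂ)⁻¹ * ∑ j ∈ Finset.range T, q ^ j) atTop (𝓝 0) := by
  have h1 : Tendsto (fun T : ℕ => (T : ℝ)⁻¹ * (2 / ‖q - 1‖)) atTop (𝓝 0) := by
    simpa using tendsto_natCast_atTop_atTop.inv_tendsto_atTop.mul_const (2 / ‖q - 1‖)
  refine squeeze_zero_norm (fun T => ?_) h1
  rw [norm_mul, norm_inv, Complex.norm_natCast, geom_sum_eq hq1, norm_div]
  gcongr
  calc ‖q ^ T - 1‖ ≤ ‖q ^ T‖ + ‖(1 : ℂ)‖ := norm_sub_le _ _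
    _ = 2 := by rw [norm_pow, hq]; norm_num

theorem ofReal_form (x y : Fin n → ℝ) :
    form B (fun i => (x i : ℂ)) (fun i => (y i : ℂ)) = ((form B x y : ℝ) : ℂ) :=
  map_form Complex.ofRealHom x y

theorem expo_add (l : Fin n → ℚ) (z w : Fin n → ℂ) :
    expo B l (z + w) = expo B l z * expo B l w := by
  rw [expo, expo, expo, ← Complex.exp_add, form_add_right]
  ring_nf

theorem expo_nsmul (l : Fin n → ℚ) (z : Fin n → ℂ) (j : ℕ) :
    expo B l ((j : ℂ) • z) = expo B l z ^ j := by
  rw [expo, expo, ← Complex.exp_nat_mul, form_smul_right]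
  ring_nf

theorem expo_sub_left (l l' : Fin n → ℚ) (z : Fin n → ℂ) :
    expo B (l - l') z = expo B l z * (expo B l' z)⁻¹ := by
  have e : (fun i => (((l - l') i : ℚ) : ℂ)) = (fun i => (l i : ℂ)) - fun i => (l' i : ℂ) := by
    funext i; simp
  rw [expo, expo, expo, ← Complex.exp_neg, ← Complex.exp_add, e, form_sub_left]
  ring_nf

theorem expo_ne_zero (l : Fin n → ℚ) (z : Fin n → ℂ) : expo B l z ≠ 0 := Complex.exp_ne_zero _

theorem expo_ofReal (l : Fin n → ℚ) (x : Fin n → ℝ) : expo B l (fun i => (x i : ℂ)) =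
    Complex.exp ((-2 * Real.pi * form B (fun i => (l i : ℝ)) x : ℝ) * Complex.I) := by
  have := ofReal_form (B := B) (fun i => (l i : ℝ)) x
  simp only [Complex.ofReal_ratCast] at this
  rw [expo, this]
  push_cast
  ring_nf

theorem norm_expo_ofReal (l : Fin n → ℚ) (x : Fin n → ℝ) :
    ‖expo B l (fun i => (x i : ℂ))‖ = 1 := by
  rw [expo_ofReal, Complex.norm_exp_ofReal_mul_I]

theorem norm_expo (l : Fin n → ℚ) (z : Fin n → ℂ) : ‖expo B l z‖ =
    Real.exp (2 * Real.pi * form B (fun i => (l i : ℝ)) (fun i => (z i).im)) := by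
  have e : z = (fun i => ((z i).re : ℂ)) + Complex.I • (fun i => ((z i).im : ℂ)) := by
    funext i
    simp only [Pi.add_apply, Pi.smul_apply, smul_eq_mul]
    rw [mul_comm, Complex.re_add_im]
  have h2 := ofReal_form (B := B) (fun i => (l i : ℝ)) (fun i => (z i).im)
  simp only [Complex.ofReal_ratCast] at h2
  conv_lhs => rw [e, expo_add, norm_mul, norm_expo_ofReal, one_mul]
  rw [expo, form_smul_right, h2, Complex.norm_exp]
  congr 1
  have : (-2 * (Real.pi : ℂ) * Complex.I * (Complex.I *
      ((form B (fun i => (l i : ℝ)) (fun i => (z i).im) : ℝ) : ℂ))) =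
      ((2 * Real.pi * form B (fun i => (l i : ℝ)) (fun i => (z i).im) : ℝ) : ℂ) := by
    push_cast
    linear_combination (-2 * (Real.pi : ℂ) *
      ((form B (fun i => (l i : ℝ)) (fun i => (z i).im) : ℝ) : ℂ)) * Complex.I_mul_I
  rw [this, Complex.ofReal_re]

theorem add_ofReal_mem_tube {z : Fin n → ℂ} (hz : z ∈ tube B u) (x : Fin n → ℝ) :
    z + (fun i => (x i : ℂ)) ∈ tube B u := by
  change (fun i => ((z + fun i => (x i : ℂ)) i).im) ∈ posCone B u
  simpa using (show (fun i => (z i).im) ∈ posCone B u from hz)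

/-- An absolutely convergent Fourier series on the tube that vanishes has zero coefficients. -/
theorem IsHyperbolic.fourier_unique (hB : IsHyperbolic B) (hu : form B u u < 0)
    {h : (Fin n → ℚ) → ℂ} (hh : ∀ z ∈ tube B u, HasSum (fun l => h l * expo B l z) 0) :
    h = 0 := by
  obtain ⟨x, hx⟩ := hB.exists_generic
  set X : Fin n → ℂ := fun i => (x i : ℂ) with hX
  set z : Fin n → ℂ := fun i => Complex.I * (u i : ℂ) with hz
  have hzt : z ∈ tube B u := by
    change (fun i => (z i).im) ∈ posCone B u
    simpa [hz] using self_mem_posCone hu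
  funext l₀
  have hq : ∀ l, ‖expo B (l - l₀) X‖ = 1 := fun l => norm_expo_ofReal _ _
  -- Average the series over the translates `z + jX`, after division by the character of `l₀`. The
  -- direction `X` is generic, so every other exponent rotates nontrivially and averages out as `T →
  -- ∞`.
  have hmean : ∀ T : ℕ, HasSum (fun l => h l * expo B l z *
      ((T : ℂ)⁻¹ * ∑ j ∈ Finset.range T, expo B (l - l₀) X ^ j)) 0 := by
    intro T
    have h1 : ∀ j ∈ Finset.range T, HasSum (fun l => h l * expo B l z *
        expo B (l - l₀) X ^ j) 0 := by
      intro j _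
      have hm : z + (j : ℂ) • X ∈ tube B u := by
        have := add_ofReal_mem_tube hzt (fun i => (j : ℝ) * x i)
        convert this using 2
        funext i
        simp [hX]
      have := (hh _ hm).mul_right ((expo B l₀ X ^ j)⁻¹)
      rw [zero_mul] at this
      refine this.congr_fun fun l => ?_
      rw [expo_add, expo_nsmul, expo_sub_left, mul_pow, inv_pow]
      ring
    have h2 := (hasSum_sum h1).mul_left ((T : ℂ)⁻¹)
    rw [Finset.sum_const_zero, mul_zero] at h2
    refine h2.congr_fun fun l => ?_
    rw [← Finset.mul_sum]
    ring
  have hlim := tendsto_tsum_of_dominated_convergence (𝓕 := atTop)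
    (f := fun (T : ℕ) l => h l * expo B l z * ((T : ℂ)⁻¹ * ∑ j ∈ Finset.range T, expo B (l - l₀) X ^ j))
    (g := fun l => if l = l₀ then h l₀ * expo B l₀ z else 0)
    (bound := fun l => ‖h l * expo B l z‖) (hh z hzt).summable.norm (by
      intro l
      by_cases hl : l = l₀
      · subst hl
        have he : expo B (l - l) X = 1 := by
          rw [expo_sub_left, mul_inv_cancel₀ (expo_ne_zero _ _)]
        rw [if_pos rfl]
        refine tendsto_const_nhds.congr' ?_
        filter_upwards [eventually_gt_atTop 0] with T hT
        have hT' : (T : ℂ) ≠ 0 := by exact_mod_cast hT.ne'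
        simp only [he, one_pow, Finset.sum_const, Finset.card_range, nsmul_eq_mul, mul_one]
        rw [inv_mul_cancel₀ hT', mul_one]
      · rw [if_neg hl]
        have hne : expo B (l - l₀) X ≠ 1 := by
          intro he
          rw [hX, expo_ofReal, Complex.exp_eq_one_iff] at he
          obtain ⟨k, hk⟩ := he
          have h3 : ((-2 * Real.pi * form B (fun i => ((l - l₀) i : ℝ)) x : ℝ) : ℂ) =
              ((k * (2 * Real.pi) : ℝ) : ℂ) := by
            apply mul_right_cancel₀ Complex.I_ne_zero
            rw [hk]; push_cast; ring
          have h4 := Complex.ofReal_injective h3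
          have h5 : form B (fun i => ((l - l₀) i : ℝ)) x = ((-k : ℤ) : ℝ) := by
            push_cast
            have hpi := Real.pi_pos
            apply mul_left_cancel₀ (mul_ne_zero two_ne_zero hpi.ne')
            linarith
          exact hl (sub_eq_zero.1 (hx _ _ h5))
        simpa using (tendsto_mean_pow (hq l) hne).const_mul (h l * expo B l z)) (by
      refine Eventually.of_forall fun T l => ?_
      rw [norm_mul (h l * expo B l z)]
      exact mul_le_of_le_one_right (norm_nonneg _) (norm_mean_pow_le (hq l) T))
  simp only [fun T => (hmean T).tsum_eq, tsum_ite_eq] at hlim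
  have := tendsto_nhds_unique hlim tendsto_const_nhds
  exact (mul_eq_zero.1 this).resolve_right (expo_ne_zero _ _)

end FourierUniqueness

/-! ### Automorphisms of `S` inside `O⁺(T)` -/

section Embedding

variable {n : ℕ} {B : Matrix (Fin n) (Fin n) ℤ} {u : Fin n → ℝ} {m : ℕ}

/-- The automorphisms of `S` act on `H(m) ⊕ S`, trivially on the first summand. -/
def extendHom (n : ℕ) : GL (Fin n) ℤ →* GL (Fin 2 ⊕ Fin n) ℤ :=
  Units.map
    { toFun := fun M => Matrix.fromBlocks 1 0 0 M
      map_one' := Matrix.fromBlocks_one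
      map_mul' := fun M N => by simp [Matrix.fromBlocks_multiply] }

theorem extendHom_val (g : GL (Fin n) ℤ) :
    (extendHom n g).val = Matrix.fromBlocks 1 0 0 g.val := rfl

theorem act_extendHom_omega {g : GL (Fin n) ℤ} (hg : g ∈ orthGroup B) (z : Fin n → ℂ) :
    act (extendHom n g) (omega B m z) = omega B m (act g z) := by
  have e : (extendHom n g).val.map (Int.cast : ℤ → ℂ) =
      Matrix.fromBlocks 1 0 0 (g.val.map (Int.cast : ℤ → ℂ)) := by
    rw [extendHom_val, Matrix.fromBlocks_map,
      Matrix.map_one _ Int.cast_zero Int.cast_one]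
    simp
  rw [act, e, Matrix.fromBlocks_mulVec, omega, omega, form_act hg]
  simp only [Sum.elim_comp_inl, Sum.elim_comp_inr, one_mulVec, zero_mulVec, add_zero, zero_add]
  rfl

theorem act_mem_tube {g : GL (Fin n) ℤ} (hg : g ∈ orthPlus B u) {z : Fin n → ℂ}
    (hz : z ∈ tube B u) : act g z ∈ tube B u := by
  have e : (fun i => (act g z i).im) = act g (fun i => (z i).im) := by
    funext i
    simp [act, mulVec, dotProduct]
  change (fun i => (act g z i).im) ∈ posCone B u
  rw [e]
  exact act_mem_posCone hg hz

theorem extendHom_mem {g : GL (Fin n) ℤ} (hg : g ∈ orthPlus B u) :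
    extendHom n g ∈ orthPlusT B u m := by
  have key : ∀ h ∈ orthPlus B u, ∀ ω ∈ omegaCone B u m, act (extendHom n h) ω ∈ omegaCone B u m := by
    rintro h hh _ ⟨c, hc, z, hz, rfl⟩
    exact ⟨c, hc, act h z, act_mem_tube hh hz, by
      rw [act_smul, act_extendHom_omega hh.1]⟩
  refine ⟨?_, mem_setStab_of_forall (key g hg) ?_⟩
  · change (extendHom n g).valᵀ * extendedGram B m * (extendHom n g).val = extendedGram B m
    have h1 : g.valᵀ * B * g.val = B := hg.1
    rw [extendHom_val, extendedGram, Matrix.fromBlocks_transpose, Matrix.fromBlocks_multiply,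
      Matrix.fromBlocks_multiply]
    simp [h1]
  · rw [← map_inv]
    exact key _ ((orthPlus B u).inv_mem hg)

theorem IsHyperbolic.isPreconnected_tube (hB : IsHyperbolic B) (hu : form B u u < 0) :
    IsPreconnected (tube B u) := by
  refine Convex.isPreconnected (convex_iff_forall_pos.2 fun x hx y hy a b ha hb _ => ?_)
  change (fun i => ((a • x + b • y) i).im) ∈ posCone B u
  have e : (fun i => ((a • x + b • y) i).im) =
      a • (fun i => (x i).im) + b • (fun i => (y i).im) := by
    funext i; simp
  rw [e]
  exact hB.add_mem_posCone hu (smul_mem_posCone hx ha) (smul_mem_posCone hy hb)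

/-- The automorphic form transforms with a constant under the automorphisms of `S`. -/
theorem IsAutomorphicForm.exists_const (hB : IsHyperbolic B) (hu : form B u u < 0) {κ : ℤ}
    {G : Subgroup (GL (Fin 2 ⊕ Fin n) ℤ)} {Φ : (Fin n → ℂ) → ℂ}
    (h : IsAutomorphicForm B u m κ G Φ) {g : GL (Fin n) ℤ} (hg : g ∈ orthPlus B u)
    (hG : extendHom n g ∈ G) :
    ∃ θ : ℂ, θ ≠ 0 ∧ ∀ z ∈ tube B u, Φ (act g z) = θ * Φ z := by
  obtain ⟨-, -, -, χ, J, -, hJ, htr⟩ := h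
  have hz : ∀ z ∈ tube B u, J (extendHom n g) z ^ 2 = 1 ∧
      Φ (act g z) = χ (extendHom n g) * J (extendHom n g) z * Φ z := by
    intro z hz
    obtain ⟨h1, h2, -⟩ := htr _ hG z hz (act g z) (act_mem_tube hg hz) 1
      (by rw [act_extendHom_omega hg.1, one_smul])
    exact ⟨by rw [h1, _root_.one_zpow], h2⟩
  -- The factor is `c = 1`, so `J` is a continuous square root of `1` on the connected tube: even
  -- for half-integral weight it is a constant sign.
  have hconst : ∃ c : ℂ, c ≠ 0 ∧ ∀ z ∈ tube B u, J (extendHom n g) z = c := by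
    rcases (hB.isPreconnected_tube hu).eq_or_eq_neg_of_sq_eq (hJ _ hG)
      (continuousOn_const (c := (1 : ℂ))) (fun z hz' => by simpa using (hz z hz').1) (by simp) with h1 | h1
    · exact ⟨1, one_ne_zero, fun z hz => h1 hz⟩
    · exact ⟨-1, neg_ne_zero.2 one_ne_zero, fun z hz => h1 hz⟩
  obtain ⟨c, hc, hJc⟩ := hconst
  refine ⟨χ (extendHom n g) * c, mul_ne_zero (Units.ne_zero _) hc, fun z hz' => ?_⟩
  rw [(hz z hz').2, hJc z hz']

end Embedding

/-! ### The Fourier expansion of the automorphic form -/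

section FourierExpansion

variable {n : ℕ}

/-- The Fourier coefficients `f` of the automorphic form, with a finite index subgroup `H` of
`O⁺(S)` under which they are invariant up to constants. -/
structure RootData.IsFourierExpansion (D : RootData n) (f : (Fin n → ℚ) → ℤ) (ε : D.W →* ℤˣ)
    (H : Subgroup (GL (Fin n) ℤ)) : Prop where
  even : ∀ w : D.W, ∀ α ∈ D.P₀, IsReflection D.B α w → ε w = -1
  odd : ∀ w : D.W, ∀ α ∈ D.P₁, IsReflection D.B α w → ε w = 1
  apply_weyl : ∀ w : D.W, f (act w.1 D.ρ) = ε w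
  eq_of_ne_zero : ∀ l, f l ≠ 0 → ∃ w ∈ D.W, l = act w D.ρ ∨
    ∃ a ∈ D.chamberVectors, l = act w (D.ρ + ofInt ℚ a)
  apply_act : ∀ w : D.W, ∀ l, f (act w.1 l) = ε w * f l
  summable : ∀ z ∈ tube D.B D.u, Summable fun l => (f l : ℂ) * expo D.B l z
  le : H ≤ orthPlus D.B D.u
  relIndex : H.relIndex (orthPlus D.B D.u) ≠ 0
  invariant : ∀ h ∈ H, ∃ θ : ℂ, θ ≠ 0 ∧ ∀ l, (f (act h l) : ℂ) = θ * f l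

theorem form_cast_rat {B : Matrix (Fin n) (Fin n) ℤ} (x y : Fin n → ℚ) :
    form B (fun i => (x i : ℝ)) (fun i => (y i : ℝ)) = ((form B x y : ℚ) : ℝ) :=
  map_form (Rat.castHom ℝ) x y

theorem ofInt_rat_cast (a : Fin n → ℤ) : (fun i => ((ofInt ℚ a i : ℚ) : ℝ)) = ofInt ℝ a := by
  funext i; simp [ofInt]

theorem act_rat_cast (g : GL (Fin n) ℤ) (x : Fin n → ℚ) :
    act g (fun i => (x i : ℝ)) = fun i => ((act g x i : ℚ) : ℝ) :=
  map_act (Rat.castHom ℝ) g x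

theorem expo_act {B : Matrix (Fin n) (Fin n) ℤ} {g : GL (Fin n) ℤ} (hg : g ∈ orthGroup B)
    (l : Fin n → ℚ) (z : Fin n → ℂ) : expo B (act g l) (act g z) = expo B l z := by
  have e : (fun i => ((act g l i : ℚ) : ℂ)) = act g (fun i => (l i : ℂ)) :=
    (map_act (Rat.castHom ℂ) g l).symm
  rw [expo, expo, e, form_act hg]

variable {D : RootData n}

theorem RootData.weyl_neg {α : Fin n → ℤ} (hα : α ∈ D.P) : form D.B D.ρ (ofInt ℚ α) < 0 := by
  rw [D.weyl α hα]
  linarith [(D.root α hα).form_pos (K := ℚ)]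

/-- The Weyl vector, and its sums with vectors of the chamber, lie in distinct orbits, and have
trivial stabilizers. -/
theorem RootData.eq_of_act_eq {w w' : GL (Fin n) ℤ} (hw : w ∈ D.W) (hw' : w' ∈ D.W)
    {a a' : Fin n → ℤ} (ha : ∀ α ∈ D.P, form D.B a α ≤ 0) (ha' : ∀ α ∈ D.P, form D.B a' α ≤ 0)
    (h : act w (D.ρ + ofInt ℚ a) = act w' (D.ρ + ofInt ℚ a')) : w = w' ∧ a = a' := by
  have hdom : ∀ b : Fin n → ℤ, (∀ α ∈ D.P, form D.B b α ≤ 0) → ∀ α ∈ D.P,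
      form D.B (fun i => (((D.ρ + ofInt ℚ b) i : ℚ) : ℝ)) (ofInt ℝ α) < 0 := by
    intro b hb α hα
    rw [← ofInt_rat_cast, form_cast_rat, form_add_left, form_ofInt]
    have h1 := RootData.weyl_neg hα
    have h2 : ((form D.B b α : ℤ) : ℚ) ≤ 0 := by exact_mod_cast hb α hα
    exact_mod_cast (by linarith :
      form D.B D.ρ (ofInt ℚ α) + ((form D.B b α : ℤ) : ℚ) < 0)
  have h1 : act (w'⁻¹ * w) (D.ρ + ofInt ℚ a) = D.ρ + ofInt ℚ a' := by
    rw [act_mul_apply, h, act_inv_act]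
  -- Both vectors are strictly dominant, and a strictly dominant vector meets the dominant cone only
  -- once in its orbit.
  have h2 : w'⁻¹ * w = 1 := by
    refine RootData.eq_one_of_dominant (D.W.mul_mem (D.W.inv_mem hw') hw) (hdom a ha) ?_
    rw [act_rat_cast, h1]
    exact fun α hα => (hdom a' ha' α hα).le
  rw [h2, act_one_apply] at h1
  exact ⟨(inv_mul_eq_one.1 h2).symm, ofInt_injective (add_left_cancel h1)⟩

/-- The exponents are pairwise distinct, so the two given sums merge into one series indexed by
exponents. The group `H` is the preimage of `G` in `O⁺(S)`. -/
theorem RootData.exists_isFourierExpansion (hD : D.HasAutomorphicForm) :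
    ∃ f ε H, D.IsFourierExpansion f ε H := by
  obtain ⟨m, κ, G, Φ, ε, μ, -, hΦ, h0, h1, hsum⟩ := hD
  -- the index set and the exponents of the Fourier series
  let lam : D.W ⊕ D.W × D.chamberVectors → (Fin n → ℚ) :=
    Sum.elim (fun w => act w.1 D.ρ) (fun p => act p.1.1 (D.ρ + ofInt ℚ p.2.1))
  let c : D.W ⊕ D.W × D.chamberVectors → ℤ :=
    Sum.elim (fun w => ε w) (fun p => -(ε p.1 * μ p.2))
  have hz0 : ∀ α ∈ D.P, form D.B (0 : Fin n → ℤ) α ≤ 0 := fun α _ => by simp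
  have hr : D.ρ = D.ρ + ofInt ℚ (0 : Fin n → ℤ) := by simp
  have hinj : Function.Injective lam := by
    rintro (w | ⟨w, a⟩) (w' | ⟨w', a'⟩) h
    · change act w.1 D.ρ = act w'.1 D.ρ at h
      rw [hr] at h
      rw [Subtype.ext (RootData.eq_of_act_eq w.2 w'.2 hz0 hz0 h).1]
    · change act w.1 D.ρ = act w'.1 (D.ρ + ofInt ℚ a'.1) at h
      conv_lhs at h => rw [hr]
      exact absurd (RootData.eq_of_act_eq w.2 w'.2 hz0 a'.2.2.2 h).2.symm a'.2.1
    · change act w.1 (D.ρ + ofInt ℚ a.1) = act w'.1 D.ρ at h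
      conv_rhs at h => rw [hr]
      exact absurd (RootData.eq_of_act_eq w.2 w'.2 a.2.2.2 hz0 h).2 a.2.1
    · obtain ⟨e1, e2⟩ := RootData.eq_of_act_eq w.2 w'.2 a.2.2.2 a'.2.2.2 h
      rw [Subtype.ext e1, Subtype.ext e2]
  -- The coefficient is zero at vectors that are not exponents.
  let f : (Fin n → ℚ) → ℤ := Function.extend lam c (0 : (Fin n → ℚ) → ℤ)
  have hf : ∀ i, f (lam i) = c i := fun i => hinj.extend_apply c (0 : (Fin n → ℚ) → ℤ) i
  have hf0 : ∀ l, l ∉ range lam → f l = 0 := fun l hl => Function.extend_apply' c (0 : (Fin n → ℚ) → ℤ) l hl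
  have hsumf : ∀ z ∈ tube D.B D.u, HasSum (fun l => (f l : ℂ) * expo D.B l z) (Φ z) := by
    intro z hz
    obtain ⟨a, b, ha, hb, hab⟩ := hsum z hz
    rw [← hinj.hasSum_iff (fun l hl => by simp [hf0 l hl]), hab, sub_eq_add_neg]
    refine HasSum.sum (f := ((fun l => (f l : ℂ) * expo D.B l z) ∘ lam)) ?_ ?_
    · refine ha.congr_fun fun w => ?_
      simp only [Function.comp_apply, hf]
      rfl
    · refine hb.neg.congr_fun fun p => ?_
      simp only [Function.comp_apply, hf]
      change ((-(ε p.1 * μ p.2) : ℤ) : ℂ) * expo D.B (act p.1.1 (D.ρ + ofInt ℚ p.2.1)) z = _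
      push_cast
      ring
  refine ⟨f, ε, G.comap (extendHom n) ⊓ orthPlus D.B D.u, h0, h1, fun w => hf (Sum.inl w), ?_, ?_,
    fun z hz => (hsumf z hz).summable, inf_le_right, ?_, ?_⟩
  · intro l hl
    have : l ∈ range lam := by
      by_contra hl'
      exact hl (hf0 l hl')
    obtain ⟨w | ⟨w, a⟩, rfl⟩ := this
    · exact ⟨w, w.2, Or.inl rfl⟩
    · exact ⟨w, w.2, Or.inr ⟨a, a.2, rfl⟩⟩
  · intro w l
    let sh : D.W → D.W ⊕ D.W × D.chamberVectors → D.W ⊕ D.W × D.chamberVectors := fun w =>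
      Sum.map (fun w' => w * w') (fun p => (w * p.1, p.2))
    have hsh : ∀ w i, lam (sh w i) = act w.1 (lam i) := by
      rintro w (w' | ⟨w', a⟩) <;> exact act_mul_apply _ _ _
    by_cases hl : l ∈ range lam
    · obtain ⟨i, rfl⟩ := hl
      rw [← hsh, hf, hf]
      rcases i with w' | ⟨w', a⟩
      · change ((ε (w * w') : ℤˣ) : ℤ) = ε w * ε w'
        rw [map_mul, Units.val_mul]
      · change -(((ε (w * w') : ℤˣ) : ℤ) * μ a) = ε w * -(ε w' * μ a)
        rw [map_mul, Units.val_mul]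
        ring
    · have hl' : act w.1 l ∉ range lam := by
        rintro ⟨i, hi⟩
        refine hl ⟨sh w⁻¹ i, ?_⟩
        rw [hsh, hi]
        exact act_inv_act _ _
      rw [hf0 _ hl, hf0 _ hl', mul_zero]
  · rw [Subgroup.inf_relIndex_right, Subgroup.relIndex_comap]
    exact mt (Subgroup.relIndex_eq_zero_of_le_right
      (Subgroup.map_le_iff_le_comap.2 fun g hg => Subgroup.mem_comap.2 (extendHom_mem (m := m) hg))) hΦ.2.2.1
  · rintro h ⟨hG, hh⟩
    obtain ⟨θ, hθ, hΦθ⟩ := hΦ.exists_const D.hyperbolic D.u_neg hh hG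
    refine ⟨θ, hθ, fun l => ?_⟩
    -- Subtract `θ` times the expansion at `z` from the expansion at `h z`, re-indexed by `l ↦ h l`.
    have key : (fun l => (f (act h l) : ℂ) - θ * f l) = 0 := by
      refine D.hyperbolic.fourier_unique D.u_neg fun z hz => ?_
      have s1 := hsumf _ (act_mem_tube hh hz)
      rw [hΦθ z hz] at s1
      let e : (Fin n → ℚ) ≃ (Fin n → ℚ) :=
        ⟨act h, act h⁻¹, act_inv_act h, act_act_inv h⟩
      have s2 := (e.hasSum_iff).2 s1
      have s3 := s2.sub ((hsumf z hz).mul_left θ)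
      rw [sub_self] at s3
      refine s3.congr_fun fun l => ?_
      change _ = (f (act h l) : ℂ) * expo D.B (act h l) (act h z) - _
      rw [expo_act hh.1]
      ring
    exact sub_eq_zero.1 (congrFun key l)

end FourierExpansion

/-! ### The Koecher principle and the orbit of the Weyl vector -/

section Koecher

open Filter Topology

theorem exists_int_smul {ι : Type*} [Fintype ι] (x : ι → ℚ) :
    ∃ (N : ℤ) (r : ι → ℤ), 0 < N ∧ ofInt ℚ r = (N : ℚ) • x := by
  classical
  have hd : ∀ i, ∃ e : ℕ, ∏ j, (x j).den = (x i).den * e := fun i =>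
    Finset.dvd_prod_of_mem _ (Finset.mem_univ i)
  choose e he using hd
  refine ⟨(∏ j, (x j).den : ℕ), fun i => e i * (x i).num, ?_, ?_⟩
  · exact_mod_cast Finset.prod_pos fun j _ => (x j).den_pos
  · funext i
    have h1 : (x i) * (x i).den = (x i).num := Rat.mul_den_eq_num _
    simp only [ofInt, Pi.smul_apply, smul_eq_mul, Int.cast_natCast]
    rw [he i]
    push_cast
    rw [← h1]
    ring

variable {n : ℕ} {B : Matrix (Fin n) (Fin n) ℤ} {u : Fin n → ℝ}

/-- An open subset of the cone, stable under positive scaling, contains lattice vectors. -/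
theorem exists_int_mem {U : Set (Fin n → ℝ)} (hU : IsOpen U) (hne : U.Nonempty)
    (hs : ∀ x ∈ U, ∀ c : ℝ, 0 < c → c • x ∈ U) : ∃ a : Fin n → ℤ, ofInt ℝ a ∈ U := by
  have hd : DenseRange fun (q : Fin n → ℚ) i => (q i : ℝ) :=
    DenseRange.piMap fun _ => Rat.denseRange_cast
  obtain ⟨q, hq⟩ := hd.exists_mem_open hU hne
  obtain ⟨N, a, hN, ha⟩ := exists_int_smul q
  refine ⟨a, ?_⟩
  have := hs _ hq N (by exact_mod_cast hN)
  convert this using 1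
  funext i
  have h := congrFun ha i
  simp only [ofInt, Pi.smul_apply, smul_eq_mul] at h ⊢
  exact_mod_cast h

variable {a b : Fin n → ℤ}

theorem form_pellHom_left (hB : B.IsSymm) (hba : form B b a = 0)
    (s : Pell.Solution₁ (-(form B a a * form B b b))) (x : Fin n → ℤ) :
    form B (act (pellHom B a b hB hba s) x) a = (1 - 2 * s.y ^ 2 * form B a a * form B b b) *
      form B x a + 2 * s.x * s.y * form B a a * form B x b := by
  rw [act_pellHom, form_sub_left, form_add_left, form_smul_left, form_smul_left, hba]
  ring

theorem form_pellHom_right (hB : B.IsSymm) (hba : form B b a = 0)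
    (s : Pell.Solution₁ (-(form B a a * form B b b))) (x : Fin n → ℤ) :
    form B (act (pellHom B a b hB hba s) x) b = (1 - 2 * s.y ^ 2 * form B a a * form B b b) *
      form B x b - 2 * s.x * s.y * form B b b * form B x a := by
  rw [act_pellHom, form_sub_left, form_add_left, form_smul_left, form_smul_left,
    form_comm hB a b, hba]
  ring

theorem exists_ne_zero_orthogonal (hn : 2 ≤ n) (a : Fin n → ℤ) :
    ∃ v : Fin n → ℤ, v ≠ 0 ∧ form B v a = 0 := by
  let f : (Fin n → ℤ) →ₗ[ℤ] (Fin 1 → ℤ) :=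
    { toFun := fun x => ![form B x a]
      map_add' := fun x y => by simp [form_add_left]
      map_smul' := fun c x => by rw [form_smul_left]; simp }
  by_contra! hcon
  have hinj : Function.Injective f := by
    rw [← LinearMap.ker_eq_bot, LinearMap.ker_eq_bot']
    intro x hx
    by_contra hx0
    exact hcon x hx0 (congrFun hx 0)
  have := le_of_fin_injective ℤ f hinj
  omega

variable {D : RootData n} {f : (Fin n → ℚ) → ℤ} {ε : D.W →* ℤˣ} {H : Subgroup (GL (Fin n) ℤ)}

theorem RootData.IsFourierExpansion.apply_weyl_ne_zero (F : D.IsFourierExpansion f ε H)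
    {w : GL (Fin n) ℤ} (hw : w ∈ D.W) : f (act w D.ρ) ≠ 0 := by
  rw [F.apply_weyl ⟨w, hw⟩]
  exact Units.ne_zero _

theorem RootData.IsFourierExpansion.apply_rho (F : D.IsFourierExpansion f ε H) : f D.ρ = 1 := by
  simpa using F.apply_weyl 1

theorem RootData.IsFourierExpansion.ne_zero_of_mem (F : D.IsFourierExpansion f ε H)
    {h : GL (Fin n) ℤ} (hh : h ∈ H) {l : Fin n → ℚ} (hl : f l ≠ 0) : f (act h l) ≠ 0 := by
  obtain ⟨θ, hθ, h1⟩ := F.invariant h hh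
  have h2 := h1 l
  have h3 : (f l : ℂ) ≠ 0 := by exact_mod_cast hl
  have h4 : (f (act h l) : ℂ) ≠ 0 := by rw [h2]; exact mul_ne_zero hθ h3
  exact_mod_cast h4

theorem RootData.IsFourierExpansion.ne_zero_of_mem_W (F : D.IsFourierExpansion f ε H)
    {w : GL (Fin n) ℤ} (hw : w ∈ D.W) {l : Fin n → ℚ} (hl : f l ≠ 0) : f (act w l) ≠ 0 := by
  rw [F.apply_act ⟨w, hw⟩]
  exact mul_ne_zero (Units.ne_zero _) hl

/-- Only finitely many vectors with nonzero Fourier coefficients have nonnegative product with a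
given vector of the cone. -/
theorem RootData.IsFourierExpansion.finite_ne_zero (F : D.IsFourierExpansion f ε H)
    {y : Fin n → ℝ} (hy : y ∈ posCone D.B D.u) :
    {l | f l ≠ 0 ∧ 0 ≤ form D.B (fun i => (l i : ℝ)) y}.Finite := by
  have hz : (fun i => Complex.I * (y i : ℂ)) ∈ tube D.B D.u := by
    change (fun i => (Complex.I * (y i : ℂ)).im) ∈ posCone D.B D.u
    simpa using hy
  -- At `z = iy` the term of `l` has absolute value `|f(l)| exp(2π (l, y))`. It is at least 1 for
  -- the vectors in question, since `f` is integral, while the terms of a summable series tend to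
  -- zero.
  have h1 := (F.summable _ hz).tendsto_cofinite_zero.norm
  rw [norm_zero] at h1
  have h2 := h1.eventually (gt_mem_nhds one_pos)
  rw [eventually_cofinite] at h2
  refine h2.subset fun l hl => ?_
  rw [mem_ofPred_eq, not_lt, norm_mul, norm_expo]
  have h3 : (1 : ℝ) ≤ ‖(f l : ℂ)‖ := by
    rw [Complex.norm_intCast]
    exact_mod_cast Int.one_le_abs hl.1
  have h4 : (1 : ℝ) ≤ Real.exp (2 * Real.pi * form D.B (fun i => (l i : ℝ))
      (fun i => (Complex.I * (y i : ℂ)).im)) := by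
    apply Real.one_le_exp
    have := hl.2
    have := Real.pi_pos
    simp only [Complex.mul_im, Complex.I_re, Complex.ofReal_im, mul_zero, Complex.I_im,
      Complex.ofReal_re, one_mul, zero_add]
    positivity
  nlinarith

/-- The Koecher principle for the leading Fourier coefficient: the Weyl vector has nonpositive
product with the half cone. -/
theorem RootData.IsFourierExpansion.form_rho_nonpos (hn : 3 ≤ n) (F : D.IsFourierExpansion f ε H)
    {y : Fin n → ℝ} (hy : y ∈ posCone D.B D.u) : form D.B (fun i => (D.ρ i : ℝ)) y ≤ 0 := by
  have hB := D.hyperbolic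
  by_contra! hpos
  obtain ⟨a, ha, haρ⟩ : ∃ a : Fin n → ℤ, ofInt ℝ a ∈ {y | y ∈ posCone D.B D.u ∧
      0 < form D.B (fun i => (D.ρ i : ℝ)) y} := by
    refine exists_int_mem (isOpen_posCone.inter
      (isOpen_lt continuous_const (Continuous.form continuous_const continuous_id)))
      ⟨y, hy, hpos⟩ fun x hx c hc => ⟨smul_mem_posCone hx.1 hc, ?_⟩
    rw [form_smul_right]
    exact mul_pos hc hx.2
  have haa : form D.B a a < 0 := by
    have := ha.1
    rw [form_ofInt] at this
    exact_mod_cast this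
  obtain ⟨N, r, hN, hr⟩ := exists_int_smul D.ρ
  have hrR : ofInt ℝ r = (N : ℝ) • fun i => (D.ρ i : ℝ) := by
    funext i
    have := congrFun hr i
    simp only [ofInt, Pi.smul_apply, smul_eq_mul] at this ⊢
    exact_mod_cast this
  have hNR : (0 : ℝ) < N := by exact_mod_cast hN
  have hra : 0 < form D.B r a := by
    have : 0 < form D.B (ofInt ℝ r) (ofInt ℝ a) := by
      rw [hrR, form_smul_left]
      exact mul_pos hNR haρ
    rw [form_ofInt] at this
    exact_mod_cast this
  -- Replacing `b` by `-b` if necessary makes `(r, b) ≤ 0`, so that positive powers of the Pell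
  -- isometry increase the product with `a`.
  obtain ⟨b, hba, hbb, hsq, hrb⟩ : ∃ b, form D.B b a = 0 ∧ 0 < form D.B b b ∧
      ¬IsSquare (-(form D.B a a * form D.B b b)) ∧ form D.B r b ≤ 0 := by
    obtain ⟨v, hv, hva⟩ := exists_ne_zero_orthogonal (B := D.B) (by omega : 2 ≤ n) a
    obtain ⟨b, h1, -, h2, h3⟩ := hB.exists_nonsquare hn haa hva hv
    rcases le_total (form D.B r b) 0 with hle | hle
    · exact ⟨b, h1, h2, h3, hle⟩
    · refine ⟨-b, ?_, ?_, ?_, ?_⟩ <;> simp only [form_neg_left, form_neg_right, neg_neg, h1, neg_zero]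
      · exact h2
      · exact h3
      · linarith
  obtain ⟨s, hsx, hsy, hsH⟩ := exists_pellHom_mem hB D.u_neg hba ha hbb hsq F.relIndex
  set h := pellHom D.B a b hB.1 hba s with hh
  have hxy : 0 < s.x * s.y := mul_pos hsx hsy
  have hab : 0 < -(form D.B a a * form D.B b b) := by nlinarith
  -- All terms added to `(x, a)` and `(x, b)` have the right sign, because `a² < 0 < b²` and `x`,
  -- `y` are positive. The sign conditions persist under iteration.
  have hstep : ∀ x : Fin n → ℤ, 0 < form D.B x a → form D.B x b ≤ 0 →
      form D.B x a < form D.B (act h x) a ∧ form D.B (act h x) b ≤ 0 := by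
    intro x h1 h2
    rw [hh, form_pellHom_left, form_pellHom_right]
    have k1 : 0 < s.y ^ 2 * -(form D.B a a * form D.B b b) := by positivity
    have k2 := mul_pos k1 h1
    have k3 := mul_nonneg_of_nonpos_of_nonpos haa.le h2
    have k4 := mul_nonneg hxy.le k3
    have k5 := mul_nonpos_of_nonneg_of_nonpos k1.le h2
    have k6 := mul_pos hxy (mul_pos hbb h1)
    constructor <;> nlinarith
  have hall : ∀ k : ℕ, 0 < form D.B (act (h ^ k) r) a ∧ form D.B (act (h ^ k) r) b ≤ 0 := by
    intro k
    induction k with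
    | zero => simpa using ⟨hra, hrb⟩
    | succ k ih =>
      obtain ⟨h1, h2⟩ := hstep _ ih.1 ih.2
      rw [pow_succ', act_mul_apply]
      exact ⟨ih.1.trans h1, h2⟩
  have hmono : StrictMono fun k : ℕ => form D.B (act (h ^ k) r) a := by
    refine strictMono_nat_of_lt_succ fun k => ?_
    rw [pow_succ', act_mul_apply]
    exact (hstep _ (hall k).1 (hall k).2).1
  have hrk : ∀ k : ℕ, ofInt ℚ (act (h ^ k) r) = (N : ℚ) • act (h ^ k) D.ρ := by
    intro k
    rw [← act_ofInt, hr, act_smul]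
  have hinj : Function.Injective fun k : ℕ => act (h ^ k) D.ρ := by
    intro k k' hkk
    apply hmono.injective
    have : act (h ^ k) r = act (h ^ k') r := by
      apply ofInt_injective (R := ℚ)
      rw [hrk, hrk]
      exact congrArg _ hkk
    exact congrArg (fun x => form D.B x a) this
  refine infinite_range_of_injective hinj ((F.finite_ne_zero ha).subset ?_)
  rintro _ ⟨k, rfl⟩
  refine ⟨F.ne_zero_of_mem (H.pow_mem hsH k) (by rw [F.apply_rho]; exact one_ne_zero), ?_⟩
  have h5 : (0 : ℚ) < N * form D.B (act (h ^ k) D.ρ) (ofInt ℚ a) := by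
    rw [← form_smul_left, ← hrk, form_ofInt]
    exact_mod_cast (hall k).1
  have h6 : (0 : ℚ) < N := by exact_mod_cast hN
  have h7 := pos_of_mul_pos_right h5 h6.le
  change 0 ≤ form D.B (fun i => ((act (h ^ k) D.ρ i : ℚ) : ℝ)) (ofInt ℝ a)
  rw [← ofInt_rat_cast, form_cast_rat]
  exact_mod_cast h7.le

/-- If `ρ² > 0`, the real reflection in `ρ` preserves `V⁺` and changes the sign of the product with
`ρ`, so `ρ` would be orthogonal to the open cone `V⁺`. -/
theorem RootData.IsFourierExpansion.form_rho_rho_nonpos (hn : 3 ≤ n)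
    (F : D.IsFourierExpansion f ε H) : form D.B D.ρ D.ρ ≤ 0 := by
  have hB := D.hyperbolic
  suffices form D.B (fun i => (D.ρ i : ℝ)) (fun i => (D.ρ i : ℝ)) ≤ 0 by
    rw [form_cast_rat] at this
    exact_mod_cast this
  set R : Fin n → ℝ := fun i => (D.ρ i : ℝ) with hR
  by_contra! hpos
  have h0 : ∀ y ∈ posCone D.B D.u, form D.B R y = 0 := by
    intro y hy
    have hyR := form_comm hB.1 y R
    refine le_antisymm (F.form_rho_nonpos hn hy) ?_
    have hm : y - (2 * form D.B R y / form D.B R R) • R ∈ posCone D.B D.u := by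
      refine hB.mem_posCone D.u_neg hy ?_ ?_
      · simp only [form_sub_left, form_sub_right, form_smul_left, form_smul_right, hyR]
        have := hy.1
        field_simp
        nlinarith
      · rw [form_sub_left, form_smul_left]
        have h1 := hy.1
        have h2 : 0 ≤ 2 * form D.B R y / form D.B R R * form D.B R y := by
          rw [div_mul_eq_mul_div]
          exact div_nonneg (by nlinarith [mul_self_nonneg (form D.B R y)]) hpos.le
        linarith
    have h3 := F.form_rho_nonpos hn hm
    rw [form_sub_right, form_smul_right, div_mul_cancel₀ _ hpos.ne'] at h3
    linarith
  obtain ⟨δ, hδ, hm⟩ := exists_pos_of_eventually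
    (isOpen_posCone.mem_nhds (self_mem_posCone D.u_neg)) R
  have h4 := h0 _ hm
  rw [form_add_right, h0 _ (self_mem_posCone D.u_neg), form_smul_right, zero_add] at h4
  exact (mul_pos hδ hpos).ne' h4

variable (D) in
theorem RootData.rho_ne_zero : D.ρ ≠ 0 := by
  obtain ⟨α, hα⟩ := D.P_nonempty
  intro h
  have := RootData.weyl_neg hα
  rw [h, form_zero_left] at this
  exact lt_irrefl _ this

/-- An automorphism of the `ℤ`-module has no rational eigenvector with eigenvalue larger
than `1`. -/
theorem not_act_eq_smul {x : Fin n → ℚ} (hx : x ≠ 0) {g : GL (Fin n) ℤ} {c : ℝ} (hc : 1 < c) :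
    act g (fun i => (x i : ℝ)) ≠ c • fun i => (x i : ℝ) := by
  intro h
  have hc0 : c ≠ 0 := by linarith
  obtain ⟨N, r, hN, hr⟩ := exists_int_smul x
  have hrR : ofInt ℝ r = (N : ℝ) • fun i => (x i : ℝ) := by
    funext i
    have := congrFun hr i
    simp only [ofInt, Pi.smul_apply, smul_eq_mul] at this ⊢
    exact_mod_cast this
  -- The powers of `g⁻¹` would carry the nonzero integral vector `r` to integral vectors `c⁻ᵏ r`,
  -- nonzero but arbitrarily small.
  have h1 : act g⁻¹ (ofInt ℝ r) = c⁻¹ • ofInt ℝ r := by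
    apply act_injective g
    rw [act_act_inv, act_smul, hrR, act_smul, h, smul_comm c⁻¹, smul_smul c⁻¹,
      inv_mul_cancel₀ hc0, one_smul]
  have h2 : ∀ k : ℕ, act (g⁻¹ ^ k) (ofInt ℝ r) = (c⁻¹) ^ k • ofInt ℝ r := by
    intro k
    induction k with
    | zero => simp
    | succ k ih => rw [pow_succ, act_mul_apply, h1, act_smul, ih, smul_smul, pow_succ, mul_comm]
  have hri : ∃ i, r i ≠ 0 := by
    by_contra! hcon
    apply hx
    have hz : ofInt ℚ r = 0 := by funext i; simp [ofInt, hcon i]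
    rw [hz] at hr
    exact (smul_eq_zero.1 hr.symm).resolve_left (by exact_mod_cast hN.ne')
  obtain ⟨i, hi⟩ := hri
  have hipos : (0 : ℝ) < |(r i : ℝ)| := abs_pos.2 (by exact_mod_cast hi)
  obtain ⟨k, hk⟩ := exists_pow_lt_of_lt_one (inv_pos.2 hipos) (inv_lt_one_of_one_lt₀ hc)
  have h3 := congrFun (h2 k) i
  rw [act_ofInt] at h3
  simp only [ofInt, Pi.smul_apply, smul_eq_mul] at h3
  have hck : 0 < (c⁻¹) ^ k := by positivity
  have h4 : act (g⁻¹ ^ k) r i ≠ 0 := by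
    intro h0
    rw [h0, Int.cast_zero] at h3
    exact (mul_ne_zero hck.ne' (abs_pos.1 hipos)) h3.symm
  have h5 : (1 : ℝ) ≤ |((act (g⁻¹ ^ k) r i : ℤ) : ℝ)| := by
    exact_mod_cast Int.one_le_abs h4
  rw [h3, abs_mul, abs_of_pos hck] at h5
  have h6 := mul_lt_mul_of_pos_right hk hipos
  rw [inv_mul_cancel₀ hipos.ne'] at h6
  linarith

/-- A vector in the orbit of the Weyl vector under isometries, with nonzero Fourier coefficient,
is in the orbit of the Weyl vector under `W`. -/
theorem RootData.IsFourierExpansion.exists_eq_act (hn : 3 ≤ n) (F : D.IsFourierExpansion f ε H)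
    {h : GL (Fin n) ℤ} (hh : h ∈ orthGroup D.B) (hf : f (act h D.ρ) ≠ 0) :
    ∃ w ∈ D.W, act h D.ρ = act w D.ρ := by
  have hB := D.hyperbolic
  obtain ⟨w, hw, h1 | ⟨a, ⟨ha0, hacl, -⟩, h1⟩⟩ := F.eq_of_ne_zero _ hf
  · exact ⟨w, hw, h1⟩
  exfalso
  set R : Fin n → ℝ := fun i => (D.ρ i : ℝ) with hR
  set A := ofInt ℝ a with hA
  set g := w⁻¹ * h with hg
  have hgo : g ∈ orthGroup D.B := (orthGroup D.B).mul_mem ((orthGroup D.B).inv_mem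
    (D.W_le_orth hw)) hh
  have h2 : act g D.ρ = D.ρ + ofInt ℚ a := by rw [hg, act_mul_apply, h1, act_inv_act]
  have h3 : act g R = R + A := by
    rw [hR, act_rat_cast, h2, hA, ← ofInt_rat_cast]
    funext i
    simp
  have hu := self_mem_posCone D.u_neg
  have hRA : form D.B R A ≤ 0 := by
    rw [form_comm hB.1]
    refine form_nonpos_of_mem_closure hacl fun z hz => ?_
    rw [form_comm hB.1]
    exact F.form_rho_nonpos hn hz
  have hAA : form D.B A A ≤ 0 := form_self_nonpos_of_mem_closure hacl
  have hRR : form D.B R R ≤ 0 := by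
    rw [hR, form_cast_rat]
    exact_mod_cast F.form_rho_rho_nonpos hn
  have h4 : form D.B (R + A) (R + A) = form D.B R R := by rw [← h3, form_act hgo]
  rw [form_add_left, form_add_right, form_add_right, form_comm hB.1 A R] at h4
  -- Equality of squares gives `2 (ρ, a) + a² = 0` with both terms nonpositive.
  have hRA0 : form D.B R A = 0 := by linarith
  have hAA0 : form D.B A A = 0 := by linarith
  have hA0 : A ≠ 0 := mt ofInt_eq_zero.1 ha0
  have hAu0 : form D.B A D.u ≠ 0 := fun h0 => (hB.form_pos D.u_neg h0 hA0).ne' hAA0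
  have hAu : form D.B A D.u < 0 := lt_of_le_of_ne (form_nonpos_of_mem_closure hacl
    fun z hz => (hB.form_neg_of_mem D.u_neg hz hu).le) hAu0
  have hRu : form D.B R D.u ≤ 0 := F.form_rho_nonpos hn hu
  -- The combination `ρ - t a` is orthogonal to `u` and has square `ρ² ≤ 0`, so it vanishes. Hence
  -- `gρ = ρ + a = (1 + 1/t) ρ`.
  set t := form D.B R D.u / form D.B A D.u with ht
  have ht0 : 0 ≤ t := div_nonneg_of_nonpos hRu hAu.le
  have h5 : R - t • A = 0 := by
    by_contra hne
    have h6 := hB.form_pos D.u_neg (x := R - t • A) (by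
      rw [form_sub_left, form_smul_left, ht, div_mul_cancel₀ _ hAu0, sub_self]) hne
    simp only [form_sub_left, form_sub_right, form_smul_left, form_smul_right,
      form_comm hB.1 A R, hRA0, hAA0] at h6
    linarith
  have h6 : R = t • A := sub_eq_zero.1 h5
  have htne : t ≠ 0 := by
    intro h0
    rw [h0, zero_smul] at h6
    apply D.rho_ne_zero
    funext i
    have := congrFun h6 i
    simpa [hR] using this
  have htpos : 0 < t := lt_of_le_of_ne ht0 htne.symm
  refine not_act_eq_smul D.rho_ne_zero (g := g) (c := 1 + t⁻¹) (by
    have := inv_pos.2 htpos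
    linarith) ?_
  rw [← hR, h3, add_smul, one_smul]
  congr 1
  rw [h6, smul_smul, inv_mul_cancel₀ htne, one_smul]

end Koecher

/-! ### Symmetries of the chamber -/

section Symmetries

variable {n : ℕ} {D : RootData n} {f : (Fin n → ℚ) → ℤ} {ε : D.W →* ℤˣ}
  {H : Subgroup (GL (Fin n) ℤ)}

theorem RootData.act_reflection_rho {α : Fin n → ℤ} (hα : α ∈ D.P) {s : GL (Fin n) ℤ}
    (hs : IsReflection D.B α s) : act s D.ρ = D.ρ + ofInt ℚ α := by
  have hpos := (D.root α hα).form_pos (K := ℚ)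
  rw [hs.act_eq, D.weyl α hα]
  have : 2 * (-form D.B (ofInt ℚ α) (ofInt ℚ α) / 2) / form D.B (ofInt ℚ α) (ofInt ℚ α) = -1 := by
    field_simp
  rw [this]
  simp

/-- An isometry that fixes the Weyl vector and preserves the support of the Fourier series
expands the chamber. -/
theorem RootData.IsFourierExpansion.act_inv_mem_C (hn : 3 ≤ n) (F : D.IsFourierExpansion f ε H)
    {g : GL (Fin n) ℤ} (hg : g ∈ orthPlus D.B D.u) (hρ : act g D.ρ = D.ρ)
    (hsupp : ∀ l, f l ≠ 0 → f (act g l) ≠ 0) {x : Fin n → ℝ} (hx : x ∈ D.C) :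
    act g⁻¹ x ∈ D.C := by
  refine RootData.mem_C.2 ⟨act_mem_posCone ((orthPlus D.B D.u).inv_mem hg)
    (RootData.mem_C.1 hx).1, fun α hα => ?_⟩
  obtain ⟨s, hsW, hs⟩ := RootData.exists_reflection hα
  -- The vector `g(ρ + α) = ρ + gα` is an exponent in the isometry orbit of `ρ`, so it equals `wρ`
  -- for some `w ∈ W`. Maximality of `ρ` on the chamber then says `(x, gα) ≤ 0`.
  have h1 : f (act (g * s) D.ρ) ≠ 0 := by
    rw [act_mul_apply]
    exact hsupp _ (F.apply_weyl_ne_zero hsW)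
  obtain ⟨w, hw, h2⟩ := F.exists_eq_act hn
    ((orthGroup D.B).mul_mem hg.1 (D.W_le_orth hsW)) h1
  rw [act_mul_apply, RootData.act_reflection_rho hα hs, act_add, hρ] at h2
  have h3 := RootData.form_act_le hw (v := fun i => (D.ρ i : ℝ)) (fun β hβ => by
    rw [← ofInt_rat_cast, form_cast_rat]
    exact_mod_cast (RootData.weyl_neg hβ).le) hx
  have h4 : act w (fun i => (D.ρ i : ℝ)) = (fun i => (D.ρ i : ℝ)) + act g (ofInt ℝ α) := by
    rw [act_rat_cast, ← h2, ← ofInt_rat_cast α, act_rat_cast]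
    funext i
    simp
  rw [h4, form_add_right, form_act_right hg.1] at h3
  linarith

/-- With `gρ = wρ`, both `w⁻¹g` and its inverse fix `ρ` and preserve the support of `f`, so the
chamber is mapped into itself in both directions. -/
theorem RootData.IsFourierExpansion.exists_mem_symM (hn : 3 ≤ n) (F : D.IsFourierExpansion f ε H)
    {g : GL (Fin n) ℤ} (hg : g ∈ H) :
    ∃ w ∈ D.W, w⁻¹ * g ∈ D.symM ∧ act g D.ρ = act w D.ρ := by
  have hgp := F.le hg
  have hρ1 : f D.ρ ≠ 0 := by rw [F.apply_rho]; exact one_ne_zero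
  obtain ⟨w, hw, h1⟩ := F.exists_eq_act hn hgp.1 (F.ne_zero_of_mem hg hρ1)
  have hm : w⁻¹ * g ∈ orthPlus D.B D.u :=
    (orthPlus D.B D.u).mul_mem (D.W_le (D.W.inv_mem hw)) hgp
  have h2 : act (w⁻¹ * g) D.ρ = D.ρ := by rw [act_mul_apply, h1, act_inv_act]
  have h3 : act (w⁻¹ * g)⁻¹ D.ρ = D.ρ := by
    conv_lhs => rw [← h2]
    exact act_inv_act _ _
  refine ⟨w, hw, ⟨hm, mem_setStab_of_forall (fun x hx => ?_) fun x hx => ?_⟩, h1⟩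
  · have := F.act_inv_mem_C hn ((orthPlus D.B D.u).inv_mem hm) h3 (fun l hl => by
      rw [_root_.mul_inv_rev, inv_inv, act_mul_apply]
      exact F.ne_zero_of_mem (H.inv_mem hg) (F.ne_zero_of_mem_W hw hl)) hx
    rwa [inv_inv] at this
  · exact F.act_inv_mem_C hn hm h2 (fun l hl => by
      rw [act_mul_apply]
      exact F.ne_zero_of_mem_W (D.W.inv_mem hw) (F.ne_zero_of_mem hg hl)) hx

theorem RootData.IsFourierExpansion.le_sup (hn : 3 ≤ n) (F : D.IsFourierExpansion f ε H) :
    H ≤ D.W ⊔ D.symM := by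
  intro g hg
  obtain ⟨w, hw, h, -⟩ := F.exists_mem_symM hn hg
  have := (D.W ⊔ D.symM).mul_mem (Subgroup.mem_sup_left hw) (Subgroup.mem_sup_right h)
  rwa [mul_inv_cancel_left] at this

/-- In the factorization `g = w (w⁻¹g)` the element `w` lies in `W ∩ Sym(𝓜)`, which is trivial. -/
theorem RootData.IsFourierExpansion.act_rho (hn : 3 ≤ n) (F : D.IsFourierExpansion f ε H)
    {g : GL (Fin n) ℤ} (hg : g ∈ H) (hgM : g ∈ D.symM) : act g D.ρ = D.ρ := by
  obtain ⟨w, hw, h1, h2⟩ := F.exists_mem_symM hn hg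
  have h3 : w⁻¹ ∈ D.symM := by
    have := D.symM.mul_mem h1 (D.symM.inv_mem hgM)
    rwa [mul_inv_cancel_right] at this
  have h4 : w ∈ D.W ⊓ D.symM := ⟨hw, by simpa using D.symM.inv_mem h3⟩
  rw [D.W_inf_symM, Subgroup.mem_bot] at h4
  rw [h2, h4, act_one_apply]

/-- A symmetry of the chamber gives only `gα = cβ`. Because `ρ` is fixed, `(ρ, gα) = -(gα)²/2`, that
is `c β² = c² β²`, so `c = 1`. -/
theorem RootData.act_mem_P {g : GL (Fin n) ℤ} (hg : g ∈ D.symM) (hρ : act g⁻¹ D.ρ = D.ρ)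
    {α : Fin n → ℤ} (hα : α ∈ D.P) : act g α ∈ D.P := by
  obtain ⟨β, hβ, c, hc, he⟩ := RootData.exists_act_eq_smul hg hα
  have hβpos := (D.root β hβ).form_pos (K := ℝ)
  have hw : ∀ γ ∈ D.P, form D.B (fun i => (D.ρ i : ℝ)) (ofInt ℝ γ) =
      -form D.B (ofInt ℝ γ) (ofInt ℝ γ) / 2 := by
    intro γ hγ
    rw [← ofInt_rat_cast, form_cast_rat, form_cast_rat, D.weyl γ hγ]
    push_cast
    rfl
  have h1 : form D.B (fun i => (D.ρ i : ℝ)) (ofInt ℝ (act g α)) =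
      form D.B (fun i => (D.ρ i : ℝ)) (ofInt ℝ α) := by
    rw [← act_ofInt, form_act_right hg.1.1, act_rat_cast, hρ]
  have h2 : form D.B (ofInt ℝ (act g α)) (ofInt ℝ (act g α)) =
      form D.B (ofInt ℝ α) (ofInt ℝ α) := by
    rw [← act_ofInt, form_act hg.1.1]
  rw [hw α hα, ← h2, he, form_smul_right, form_smul_left, form_smul_right, hw β hβ] at h1
  have h3 : c = 1 := by
    have h4 : (c * form D.B (ofInt ℝ β) (ofInt ℝ β)) * (c - 1) = 0 := by linear_combination 2 * h1
    rcases mul_eq_zero.1 h4 with h5 | h5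
    · exact absurd h5 (mul_pos hc hβpos).ne'
    · linarith
  rw [h3, one_smul] at he
  rwa [ofInt_injective he]

/-- The coefficient at `ρ + α = s_α(ρ)` is `ε(s_α)`, which is `1` or `-1` according to parity. Since
`g` fixes `ρ`, where the coefficient is `1`, it preserves all coefficients exactly. -/
theorem RootData.IsFourierExpansion.act_mem_odd (F : D.IsFourierExpansion f ε H)
    {g : GL (Fin n) ℤ} (hg : g ∈ H) (hρ : act g D.ρ = D.ρ) {α : Fin n → ℤ} (hα : α ∈ D.P₁)
    (hgα : act g α ∈ D.P) : act g α ∈ D.P₁ := by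
  rcases hgα with h0 | h1
  swap
  · exact h1
  exfalso
  obtain ⟨s, hsW, hs⟩ := RootData.exists_reflection (Or.inr hα : α ∈ D.P)
  obtain ⟨t, htW, ht⟩ := RootData.exists_reflection (Or.inl h0 : act g α ∈ D.P)
  obtain ⟨θ, -, hθ⟩ := F.invariant g hg
  have hθ1 : θ = 1 := by
    have := hθ D.ρ
    rw [hρ, F.apply_rho] at this
    simpa using this.symm
  have e1 := F.apply_weyl ⟨s, hsW⟩
  have e2 := F.apply_weyl ⟨t, htW⟩
  rw [F.odd ⟨s, hsW⟩ α hα hs, RootData.act_reflection_rho (Or.inr hα) hs] at e1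
  rw [F.even ⟨t, htW⟩ _ h0 ht, RootData.act_reflection_rho (Or.inl h0) ht] at e2
  have e3 := hθ (D.ρ + ofInt ℚ α)
  rw [act_add, hρ, act_ofInt, e1, e2, hθ1] at e3
  norm_num at e3

theorem RootData.IsFourierExpansion.inf_le_symP (hn : 3 ≤ n) (F : D.IsFourierExpansion f ε H) :
    H ⊓ D.symM ≤ D.symP := by
  rintro g ⟨hg, hgM⟩
  have key : ∀ h ∈ H ⊓ D.symM, (∀ α ∈ D.P, act h α ∈ D.P) ∧ ∀ α ∈ D.P₁, act h α ∈ D.P₁ := by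
    rintro h ⟨hh, hhM⟩
    have hP : ∀ α ∈ D.P, act h α ∈ D.P := fun α hα =>
      RootData.act_mem_P hhM (F.act_rho hn (H.inv_mem hh) (D.symM.inv_mem hhM)) hα
    exact ⟨hP, fun α hα => F.act_mem_odd hh (F.act_rho hn hh hhM) hα (hP α (Or.inr hα))⟩
  have hi := key g⁻¹ ((H ⊓ D.symM).inv_mem ⟨hg, hgM⟩)
  have hd := key g ⟨hg, hgM⟩
  exact ⟨⟨hgM.1, mem_setStab_of_forall hd.1 hi.1⟩, mem_setStab_of_forall hd.2 hi.2⟩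

variable (D) in
theorem RootData.symP_le_symM : D.symP ≤ D.symM := by
  have key : ∀ g ∈ D.symP, ∀ x ∈ D.C, act g x ∈ D.C := by
    intro g hg x hx
    refine RootData.mem_C.2 ⟨act_mem_posCone hg.1.1 (RootData.mem_C.1 hx).1, fun α hα => ?_⟩
    rw [form_act_left hg.1.1.1, act_ofInt]
    exact (RootData.mem_C.1 hx).2 _
      (act_mem_of_mem_setStab ((setStab D.P).inv_mem hg.1.2) hα)
  exact fun g hg => ⟨hg.1.1, mem_setStab_of_forall (key g hg) (key _ (D.symP.inv_mem hg))⟩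

theorem RootData.IsFourierExpansion.relIndex_symP (hn : 3 ≤ n) (F : D.IsFourierExpansion f ε H) :
    D.symP.relIndex D.symM ≠ 0 := by
  have h1 : H.relIndex D.symM ≠ 0 := fun h0 => F.relIndex
    (Subgroup.relIndex_eq_zero_of_le_right (inf_le_left : D.symM ≤ orthPlus D.B D.u) h0)
  rw [← Subgroup.inf_relIndex_right] at h1
  exact fun h0 => h1 (Subgroup.relIndex_eq_zero_of_le_left (F.inf_le_symP hn) h0)

end Symmetries

/-! ### Spanning by simple roots, finite index, and the conclusion -/

section Uniqueness

variable {n : ℕ} {D : RootData n} {f : (Fin n → ℚ) → ℤ} {ε : D.W →* ℤˣ}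
  {H : Subgroup (GL (Fin n) ℤ)}

theorem RootData.act_eq_self_of_orthogonal {k : Fin n → ℤ} (hk : ∀ α ∈ D.P, form D.B k α = 0)
    {w : GL (Fin n) ℤ} (hw : w ∈ D.W) : act w k = k := by
  obtain ⟨L, hL, rfl⟩ := RootData.exists_word hw
  induction L with
  | nil => simp
  | cons s L ih =>
    obtain ⟨α, hα, hs⟩ := hL s List.mem_cons_self
    have hL' : ∀ t ∈ L, t ∈ D.simpleReflections := fun t ht => hL t (List.mem_cons_of_mem _ ht)
    rw [List.prod_cons, act_mul_apply, ih hL' (RootData.prod_mem_W hL')]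
    apply ofInt_injective (R := ℝ)
    rw [← act_ofInt, hs.act_eq, form_ofInt, hk α hα]
    simp

/-- The simple roots span: a vector orthogonal to all of them vanishes. -/
theorem RootData.IsFourierExpansion.eq_zero_of_orthogonal (hn : 3 ≤ n)
    (F : D.IsFourierExpansion f ε H) {k : Fin n → ℤ} (hk : ∀ α ∈ D.P, form D.B k α = 0) :
    k = 0 := by
  have hB := D.hyperbolic
  by_contra hk0
  -- The orthogonal complement of `P` is `H`-stable: elements of `Sym(𝓜)` permute the walls, and `W`
  -- fixes the complement pointwise.
  have hH : ∀ h ∈ H, ∀ α ∈ D.P, form D.B (act h k) α = 0 := by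
    intro h hh α hα
    obtain ⟨w, hw, hg, -⟩ := F.exists_mem_symM hn hh
    have h1 : ∀ β ∈ D.P, form D.B (act (w⁻¹ * h) k) β = 0 := by
      intro β hβ
      obtain ⟨γ, hγ, c, hc, he⟩ := RootData.exists_act_eq_smul (D.symM.inv_mem hg) hβ
      rw [form_act_left hg.1.1]
      have : form D.B (ofInt ℝ k) (ofInt ℝ (act (w⁻¹ * h)⁻¹ β)) = 0 := by
        rw [he, form_smul_right, form_ofInt, hk γ hγ, Int.cast_zero, mul_zero]
      rw [form_ofInt] at this
      exact_mod_cast this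
    have h2 := RootData.act_eq_self_of_orthogonal h1 hw
    rw [← act_mul_apply, mul_inv_cancel_left] at h2
    rw [h2]
    exact h1 α hα
  obtain ⟨α, hα⟩ := D.P_nonempty
  obtain ⟨x₀, hx₀⟩ := D.exists_basePoint
  obtain ⟨a, haV, haα⟩ : ∃ a : Fin n → ℤ, ofInt ℝ a ∈ {y | y ∈ posCone D.B D.u ∧
      form D.B y (ofInt ℝ α) < 0} := by
    refine exists_int_mem (isOpen_posCone.inter
      (isOpen_lt (Continuous.form continuous_id continuous_const) continuous_const))
      ⟨x₀, hx₀.mem, hx₀.form_neg hα⟩ fun x hx c hc => ⟨smul_mem_posCone hx.1 hc, ?_⟩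
    rw [form_smul_left]
    exact mul_neg_of_pos_of_neg hc hx.2
  have haa : form D.B a a < 0 := by
    have := haV.1
    rw [form_ofInt] at this
    exact_mod_cast this
  have haα' : form D.B a α < 0 := by
    rw [form_ofInt] at haα
    exact_mod_cast haα
  have hαα := (D.root α hα).1
  -- The vector of the plane of `k` and `α` that is orthogonal to `a`.
  set v := form D.B a α • k - form D.B a k • α with hv
  have hva : form D.B v a = 0 := by
    rw [hv, form_sub_left, form_smul_left, form_smul_left, form_comm hB.1 k a,
      form_comm hB.1 α a]
    ring
  have hv0 : v ≠ 0 := by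
    intro h0
    have h1 : form D.B v α = 0 := by rw [h0, form_zero_left]
    rw [hv, form_sub_left, form_smul_left, form_smul_left, hk α hα, mul_zero, zero_sub,
      neg_eq_zero] at h1
    have h2 := (mul_eq_zero.1 h1).resolve_right hαα.ne'
    rw [h2, zero_smul, sub_zero] at hv
    exact hk0 ((smul_eq_zero.1 (hv.symm.trans h0)).resolve_left haα'.ne)
  obtain ⟨b, hba, hbv, hbb, hsq⟩ := hB.exists_nonsquare hn haa hva hv0
  obtain ⟨s, hsx, hsy, hsH⟩ := exists_pellHom_mem hB D.u_neg hba haV hbb hsq F.relIndex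
  -- Apply stability to a Pell isometry and its inverse. Their difference isolates the part odd in
  -- `y`, which is `4xy (b, v) > 0`.
  have e1 := hH _ hsH α hα
  have e2 := hH _ (H.inv_mem hsH) α hα
  rw [← map_inv] at e2
  rw [act_pellHom, form_sub_left, form_add_left, form_smul_left, form_smul_left, hk α hα] at e1 e2
  rw [Pell.Solution₁.x_inv, Pell.Solution₁.y_inv] at e2
  have e3 : 4 * (s.x * s.y) * (form D.B k b * form D.B a α - form D.B k a * form D.B b α) = 0 := by
    linear_combination e1 - e2
  have e4 : form D.B b v = form D.B k b * form D.B a α - form D.B k a * form D.B b α := by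
    rw [hv, form_sub_right, form_smul_right, form_smul_right, form_comm hB.1 b k,
      form_comm hB.1 a k]
    ring
  rw [← e4] at e3
  have := mul_pos (mul_pos four_pos (mul_pos hsx hsy)) hbv
  linarith

/-- The Weyl vector condition is invariant under permutations of `P` by isometries, so `gρ - ρ` is
orthogonal to the spanning set `P`. -/
theorem RootData.IsFourierExpansion.act_rho_of_symP (hn : 3 ≤ n)
    (F : D.IsFourierExpansion f ε H) {g : GL (Fin n) ℤ} (hg : g ∈ D.symP) :
    act g D.ρ = D.ρ := by
  obtain ⟨N, k, hN, hk⟩ := exists_int_smul (act g D.ρ - D.ρ)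
  have ho := hg.1.1.1
  have h0 : k = 0 := by
    refine F.eq_zero_of_orthogonal hn fun α hα => ?_
    have hα' : act g⁻¹ α ∈ D.P := act_mem_of_mem_setStab ((setStab D.P).inv_mem hg.1.2) hα
    have h1 : form D.B (ofInt ℚ k) (ofInt ℚ α) = 0 := by
      have h2 := D.weyl _ hα'
      rw [← act_ofInt, form_act ((orthGroup D.B).inv_mem ho)] at h2
      rw [hk, form_smul_left, form_sub_left, form_act_left ho, h2, D.weyl α hα, sub_self, mul_zero]
    rw [form_ofInt] at h1
    exact_mod_cast h1
  rw [h0, ofInt_zero] at hk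
  have hN' : (N : ℚ) ≠ 0 := by exact_mod_cast hN.ne'
  exact sub_eq_zero.1 ((smul_eq_zero.1 hk.symm).resolve_left hN')

/-- `ρ` is fixed by a subgroup of finite index, so the orbit is parametrized by finitely many
cosets. -/
theorem RootData.IsFourierExpansion.finite_orbit (hn : 3 ≤ n) (F : D.IsFourierExpansion f ε H) :
    {y | ∃ g ∈ D.symM, y = act g D.ρ}.Finite := by
  have : (D.symP.subgroupOf D.symM).FiniteIndex := ⟨F.relIndex_symP hn⟩
  refine (finite_range fun q : D.symM ⧸ D.symP.subgroupOf D.symM =>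
    act q.out.1 D.ρ).subset ?_
  rintro _ ⟨g, hg, rfl⟩
  obtain ⟨h, hh⟩ := QuotientGroup.mk_out_eq_mul (D.symP.subgroupOf D.symM) ⟨g, hg⟩
  refine ⟨QuotientGroup.mk ⟨g, hg⟩, ?_⟩
  change act (Quotient.out (QuotientGroup.mk ⟨g, hg⟩ : D.symM ⧸ D.symP.subgroupOf D.symM)).1 D.ρ = _
  rw [hh]
  change act (g * h.1.1) D.ρ = act g D.ρ
  rw [act_mul_apply]
  exact congrArg _ (F.act_rho_of_symP hn h.2)

variable (D) in
theorem RootData.relIndex_orthPlus : (orthPlus D.B D.u).relIndex (orthGroup D.B) ≠ 0 := by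
  have hB := D.hyperbolic
  have hu := self_mem_posCone D.u_neg
  have hneg : ∀ x : Fin n → ℝ, act (-1 : GL (Fin n) ℤ) x = -x := by
    intro x
    have : ((-1 : GL (Fin n) ℤ).val.map (Int.cast : ℤ → ℝ)) = -1 := by
      ext i j
      by_cases h : i = j <;> simp [h]
    rw [act, this, neg_mulVec, one_mulVec]
  -- An isometry either preserves or exchanges the two half cones, and `-1` exchanges them.
  have hdvd : (orthPlus D.B D.u).relIndex (orthGroup D.B) ∣ 2 := by
    rw [Subgroup.relIndex_dvd_two_iff]
    have h1 : (-1 : GL (Fin n) ℤ) ∈ orthGroup D.B := by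
      change ((-1 : GL (Fin n) ℤ).val)ᵀ * D.B * (-1 : GL (Fin n) ℤ).val = D.B
      simp
    refine ⟨-1, h1, fun g hg => ?_⟩
    have h2 : form D.B (act g D.u) (act g D.u) < 0 := by rw [form_act hg]; exact D.u_neg
    rcases lt_trichotomy (form D.B (act g D.u) D.u) 0 with h | h | h
    · exact Or.inr (hB.mem_orthPlus_of_act_mem D.u_neg hg hu ⟨h2, h⟩)
    · exact absurd (hB.form_nonneg D.u_neg h) (not_le.2 h2)
    · refine Or.inl (hB.mem_orthPlus_of_act_mem D.u_neg ((orthGroup D.B).mul_mem hg h1) hu ?_)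
      rw [act_mul_apply, hneg, act_neg]
      exact ⟨by simpa [form_neg_left, form_neg_right] using h2, by simpa [form_neg_left] using h⟩
  intro h0
  rw [h0] at hdvd
  norm_num at hdvd

theorem RootData.IsFourierExpansion.semidirectFiniteIndex (hn : 3 ≤ n)
    (F : D.IsFourierExpansion f ε H) : SemidirectFiniteIndex D.B D.u D.W D.C := by
  refine ⟨sup_le D.W_le_orth fun g hg => hg.1.1, D.symM_le_normalizer, D.W_inf_symM, fun h0 => ?_⟩
  exact Subgroup.relIndex_ne_zero_trans F.relIndex D.relIndex_orthPlus
    (Subgroup.relIndex_eq_zero_of_le_left (F.le_sup hn) h0)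

theorem RootData.IsFourierExpansion.isReflective (hn : 3 ≤ n)
    (F : D.IsFourierExpansion f ε H) : IsReflective D.B := by
  -- Reflectivity asks for a lattice vector, so the denominators of `ρ` are cleared.
  obtain ⟨N, r, hN, hr⟩ := exists_int_smul D.ρ
  have hN' : (N : ℚ) ≠ 0 := by exact_mod_cast hN.ne'
  refine ⟨D.hyperbolic, D.u, D.W, D.C, r, D.u_neg,
    ⟨D.W_refl, D.W_nontrivial, D.C_chamber, F.semidirectFiniteIndex hn⟩, ?_, ?_⟩
  · rw [hr]
    exact smul_ne_zero hN' D.rho_ne_zero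
  · refine ((F.finite_orbit hn).image fun y => (N : ℚ) • y).subset ?_
    rintro _ ⟨g, hg, rfl⟩
    exact ⟨act g D.ρ, ⟨g, hg, rfl⟩, by rw [hr, act_smul]⟩

end Uniqueness

end LorentzianKM

theorem proposition1p5p2 {n : ℕ} (hn : 3 ≤ n) (D : LorentzianKM.RootData n)
    (hD : D.HasAutomorphicForm) :
    (D.ρ ≠ 0 ∧ LorentzianKM.form D.B D.ρ D.ρ ≤ 0) ∧
    LorentzianKM.SemidirectFiniteIndex D.B D.u D.W D.C ∧
    {y | ∃ g ∈ D.symM, y = LorentzianKM.act g D.ρ}.Finite ∧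
    LorentzianKM.IsReflective D.B ∧
    LorentzianKM.RestrictedArithmeticType D.B D.u D.W D.C ∧
    LorentzianKM.IsGeneralizedWeylVector D.B D.u D.C D.ρ ∧
    (D.symP ≤ D.symM ∧ D.symP.relIndex D.symM ≠ 0) ∧
    (∀ g ∈ D.symP, LorentzianKM.act g D.ρ = D.ρ) := by
  obtain ⟨f, ε, H, F⟩ := LorentzianKM.RootData.exists_isFourierExpansion hD
  exact ⟨⟨D.rho_ne_zero, F.form_rho_rho_nonpos hn⟩, F.semidirectFiniteIndex hn,
    F.finite_orbit hn, F.isReflective hn,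
    ⟨D.W_refl, D.W_nontrivial, D.C_chamber, F.semidirectFiniteIndex hn⟩,
    ⟨D.rho_ne_zero, F.finite_orbit hn⟩, ⟨D.symP_le_symM, F.relIndex_symP hn⟩,
    fun _ hg => F.act_rho_of_symP hn hg⟩
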